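/- Let $\mathcal{P} \subset \mathbb{R}^2$ be a (nondegenerate, closed) parallelogram symmetric about the origin, i.e. $\mathcal{P} = -\mathcal{P}$, and let $N \ge 2$. Let $x_1, \dots, x_N$ be independent random points, each uniformly distributed in $\mathcal{P}$, and set $$V_{\mathcal{P},N} = \frac{\mathrm{vol}_2\big(\mathrm{conv}\{\pm x_1, \pm x_2, \dots, \pm x_N\}\big)}{\mathrm{vol}_2(\mathcal{P})}.$$ Then $$\mathbb{E}\, V_{\mathcal{P},N} = 1 - \frac{4}{3(N+1)} \sum_{k=1}^{N+1} \frac{1}{k}.$$ -/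

import Mathlib

open MeasureTheory ProbabilityTheory
open scoped Pointwise

/-- A (closed, nondegenerate) parallelogram in the plane: the set
`{c + s a + t b : s, t ∈ [0, 1]}` for a point `c` and linearly independent vectors `a`, `b`. -/
def IsParallelogram (P : Set (EuclideanSpace ℝ (Fin 2))) : Prop :=
  ∃ c a b : EuclideanSpace ℝ (Fin 2), LinearIndependent ℝ ![a, b] ∧
    P = {x | ∃ s ∈ Set.Icc (0 : ℝ) 1, ∃ t ∈ Set.Icc (0 : ℝ) 1, x = c + s • a + t • b}

/-- The symmetric convex hull `conv {± x₁, …, ± x_N}` of a finite family of points. -/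
def symmConvexHull {n N : ℕ} (x : Fin N → EuclideanSpace ℝ (Fin n)) :
    Set (EuclideanSpace ℝ (Fin n)) :=
  convexHull ℝ (Set.range x ∪ Set.range (fun i => -x i))

/-- The normalized volume `vol (conv {± x₁, …, ± x_N}) / vol K`. -/
noncomputable def normalizedSymmVolume {n N : ℕ} (K : Set (EuclideanSpace ℝ (Fin n)))
    (x : Fin N → EuclideanSpace ℝ (Fin n)) : ℝ :=
  (volume (symmConvexHull x)).toReal / (volume K).toReal

/-!
A linear map reduces the problem to the square `[-1, 1]²`, where one needs the probability that the
symmetric hull of `n + 1` random points misses a further random point `z`. It does so iff some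
linear form with value `1` at `z` has absolute value less than `1` at all the points. These forms
make up an open interval, and looking at the point `y` that determines its end shows that the
probability in question is `(n + 1) E[F ^ n]`, where `F` is the mass of the strip between the line
through two random points `z`, `y` and its opposite.

With a line `y = c + m x` and two abscissas as coordinates, the pairs of points have the density
`|x₂ - x₁|`. By the symmetries of the square it suffices to integrate over `0 < m ≤ 1` and `0 < c`,
where `F` is an explicit function of `c`. The integral over `c` is a multiple of
`1 + (1 - m) + ⋯ + (1 - m) ^ (n + 1)`, which integrates to the harmonic sum.
-/

section AbsConvexHull

variable {E ι : Type*} [NormedAddCommGroup E] [NormedSpace ℝ E] [Finite ι]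

lemma isCompact_absConvexHull_range (y : ι → E) : IsCompact (absConvexHull ℝ (Set.range y)) := by
  rw [← convexHull_union_neg_eq_absConvexHull]
  exact ((Set.finite_range y).union (Set.finite_range y).neg).isCompact_convexHull ℝ

lemma absConvex_setOf_abs_lt (f : E →L[ℝ] ℝ) (r : ℝ) : AbsConvex ℝ {w | |f w| < r} := by
  have h : {w | |f w| < r} = (normSeminorm ℝ ℝ |>.comp (f : E →ₗ[ℝ] ℝ)).ball 0 r := by
    ext w; simp [Seminorm.mem_ball]
  rw [h]
  exact ⟨Seminorm.balanced_ball_zero _ r, Seminorm.convex_ball _ 0 r⟩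

lemma notMem_absConvexHull_range_iff {y : ι → E} {z : E} :
    z ∉ absConvexHull ℝ (Set.range y) ↔ ∃ f : E →L[ℝ] ℝ, ∀ i, |f (y i)| < |f z| := by
  have hmem : ∀ i, y i ∈ absConvexHull ℝ (Set.range y) := fun i =>
    subset_absConvexHull (Set.mem_range_self i)
  constructor
  · intro hz
    obtain ⟨f, u, hfu, huz⟩ := geometric_hahn_banach_closed_point
      absConvex_absConvexHull.2 (isCompact_absConvexHull_range y).isClosed hz
    refine ⟨f, fun i => (abs_lt.mpr ⟨?_, ?_⟩).trans_le (le_abs_self _)⟩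
    · have := hfu _ (balanced_absConvexHull.neg_mem_iff.mpr (hmem i))
      rw [map_neg] at this
      linarith
    · exact (hfu _ (hmem i)).trans huz
  · rintro ⟨f, hf⟩ hz
    exact lt_irrefl |f z| (absConvexHull_min (Set.range_subset_iff.mpr hf)
      (absConvex_setOf_abs_lt f |f z|) hz)

lemma isOpen_setOf_notMem_absConvexHull_range :
    IsOpen {p : (ι → E) × E | p.2 ∉ absConvexHull ℝ (Set.range p.1)} := by
  simp only [notMem_absConvexHull_range_iff, Set.ofPred_exists, Set.ofPred_forall]
  exact isOpen_iUnion fun f => isOpen_iInter_of_finite fun i =>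
    isOpen_lt (by fun_prop) (by fun_prop)

end AbsConvexHull

section RandomIntervals

variable {α : Type*} [MeasurableSpace α]

lemma measurableSet_forall_ne_mem {ι : Type*} [Countable ι] {S : α → Set α}
    (hS : MeasurableSet {p : α × α | p.2 ∈ S p.1}) (i : ι) :
    MeasurableSet {y : ι → α | ∀ j, j ≠ i → y j ∈ S (y i)} := by
  simp only [Set.ofPred_forall]
  exact MeasurableSet.iInter fun j => MeasurableSet.iInter fun _ =>
    hS.preimage (f := fun y : ι → α => (y i, y j)) (by fun_prop)

variable {ν : Measure α} [SigmaFinite ν] {n : ℕ}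

lemma pi_forall_ne_mem {S : α → Set α} (hS : MeasurableSet {p : α × α | p.2 ∈ S p.1})
    (i : Fin (n + 1)) :
    Measure.pi (fun _ : Fin (n + 1) => ν) {y | ∀ j, j ≠ i → y j ∈ S (y i)} =
      ∫⁻ x, ν (S x) ^ n ∂ν := by
  have hT : MeasurableSet {p : α × (Fin n → α) | ∀ j, p.2 j ∈ S p.1} := by
    simp only [Set.ofPred_forall]
    exact MeasurableSet.iInter fun j =>
      hS.preimage (f := fun p : α × (Fin n → α) => (p.1, p.2 j)) (by fun_prop)
  have hpre : {y : Fin (n + 1) → α | ∀ j, j ≠ i → y j ∈ S (y i)} =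
      MeasurableEquiv.piFinSuccAbove (fun _ => α) i ⁻¹'
        {p : α × (Fin n → α) | ∀ j, p.2 j ∈ S p.1} := by
    ext y
    simp only [Set.mem_ofPred_eq, Set.mem_preimage, Fin.forall_iff_succAbove i, ne_eq,
      not_true_eq_false, false_implies, true_and, Fin.succAbove_ne, not_false_eq_true,
      forall_const]
    rfl
  rw [hpre, (measurePreserving_piFinSuccAbove (fun _ => ν) i).measure_preimage
    hT.nullMeasurableSet, Measure.prod_apply hT]
  refine lintegral_congr fun x => ?_
  have hfiber : Prod.mk x ⁻¹' {p : α × (Fin n → α) | ∀ j, p.2 j ∈ S p.1} =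
      Set.univ.pi fun _ => S x := by
    ext y
    simp only [Set.mem_preimage, Set.mem_ofPred_eq, Set.mem_univ_pi]
  rw [hfiber, Measure.pi_pi, Finset.prod_const, Finset.card_univ, Fintype.card_fin]

variable {l r : α → ℝ}

lemma pi_exists_forall_mem_Ioo_le (hl : Measurable l) (hr : Measurable r)
    (hr0 : ∀ t, ν {w | r w = t} = 0) :
    Measure.pi (fun _ : Fin (n + 1) => ν) {y | ∃ s, ∀ j, s ∈ Set.Ioo (l (y j)) (r (y j))} ≤
      (n + 1) * ∫⁻ x, ν {w | r x ∈ Set.Ioo (l w) (r w)} ^ n ∂ν := by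
  have hIoc : MeasurableSet {p : α × α | r p.1 ∈ Set.Ioc (l p.2) (r p.2)} :=
    (measurableSet_lt (f := fun p : α × α => l p.2) (by fun_prop) (by fun_prop)).inter
      (measurableSet_le (g := fun p : α × α => r p.2) (by fun_prop) (by fun_prop))
  have hsub : {y : Fin (n + 1) → α | ∃ s, ∀ j, s ∈ Set.Ioo (l (y j)) (r (y j))} ⊆
      ⋃ i, {y | ∀ j, j ≠ i → y j ∈ {w | r (y i) ∈ Set.Ioc (l w) (r w)}} := by
    rintro y ⟨s, hs⟩
    obtain ⟨i, hi⟩ := Finite.exists_min fun j => r (y j)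
    exact Set.mem_iUnion.mpr ⟨i, fun j _ => ⟨(hs j).1.trans (hs i).2, hi j⟩⟩
  have hnull : ∀ x, ν {w | r x ∈ Set.Ioc (l w) (r w)} ≤ ν {w | r x ∈ Set.Ioo (l w) (r w)} := by
    intro x
    refine measure_mono_ae ?_
    filter_upwards [compl_mem_ae_iff.mpr (hr0 (r x))] with w hw hx
    exact ⟨hx.1, lt_of_le_of_ne hx.2 fun h => hw h.symm⟩
  refine (measure_mono hsub).trans ((measure_iUnion_fintype_le _ _).trans ?_)
  simp only [pi_forall_ne_mem (S := fun x => {w | r x ∈ Set.Ioc (l w) (r w)}) hIoc,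
    Finset.sum_const, Finset.card_univ, Fintype.card_fin,
    nsmul_eq_mul, Nat.cast_add, Nat.cast_one]
  exact mul_le_mul_right (lintegral_mono fun x => pow_le_pow_left' (hnull x) n) _

lemma le_pi_exists_forall_mem_Ioo (hl : Measurable l) (hr : Measurable r)
    (hlr : ∀ᵐ x ∂ν, l x < r x) :
    (n + 1) * ∫⁻ x, ν {w | r x ∈ Set.Ioo (l w) (r w)} ^ n ∂ν ≤
      Measure.pi (fun _ : Fin (n + 1) => ν)
        {y | ∃ s, ∀ j, s ∈ Set.Ioo (l (y j)) (r (y j))} := by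
  have hIoo : MeasurableSet {p : α × α | r p.1 ∈ Set.Ioo (l p.2) (r p.2)} :=
    (measurableSet_lt (f := fun p : α × α => l p.2) (by fun_prop) (by fun_prop)).inter
      (measurableSet_lt (g := fun p : α × α => r p.2) (by fun_prop) (by fun_prop))
  have hdisj : Pairwise (Function.onFun Disjoint fun i : Fin (n + 1) =>
      {y : Fin (n + 1) → α | ∀ j, j ≠ i → y j ∈ {w | r (y i) ∈ Set.Ioo (l w) (r w)}}) :=
    fun i k hik => Set.disjoint_left.mpr fun y hi hk =>
      lt_asymm (hi k hik.symm).2 (hk i hik).2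
  have hall : ∀ᵐ y ∂Measure.pi fun _ : Fin (n + 1) => ν, ∀ j, l (y j) < r (y j) :=
    ae_all_iff.mpr fun j =>
      (Measure.tendsto_eval_ae_ae (μ := fun _ => ν) (i := j)).eventually hlr
  have hsub : (⋃ i, {y : Fin (n + 1) → α |
        ∀ j, j ≠ i → y j ∈ {w | r (y i) ∈ Set.Ioo (l w) (r w)}} : Set _)
      ≤ᵐ[Measure.pi fun _ => ν] {y | ∃ s, ∀ j, s ∈ Set.Ioo (l (y j)) (r (y j))} := by
    filter_upwards [hall] with y hy hmem
    obtain ⟨i, hi⟩ := Set.mem_iUnion.mp hmem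
    have hri : ∀ j, l (y j) < r (y i) ∧ r (y i) ≤ r (y j) := by
      intro j
      obtain rfl | hj := eq_or_ne j i
      · exact ⟨hy j, le_rfl⟩
      · exact ⟨(hi j hj).1, (hi j hj).2.le⟩
    obtain ⟨k, hk⟩ := Finite.exists_max fun j => l (y j)
    obtain ⟨s, hks, hsi⟩ := exists_between (hri k).1
    exact ⟨s, fun j => ⟨(hk j).trans_lt hks, hsi.trans_le (hri j).2⟩⟩
  refine le_of_eq_of_le ?_ (measure_mono_ae hsub)
  rw [measure_iUnion hdisj fun i =>
    measurableSet_forall_ne_mem (S := fun x => {w | r x ∈ Set.Ioo (l w) (r w)}) hIoo i,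
    tsum_fintype]
  simp only [pi_forall_ne_mem (S := fun x => {w | r x ∈ Set.Ioo (l w) (r w)}) hIoo,
    Finset.sum_const, Finset.card_univ, Fintype.card_fin,
    nsmul_eq_mul, Nat.cast_add, Nat.cast_one]

/-- Nondegenerate open intervals have a common point iff the smallest of their right endpoints lies
in all the others; coinciding endpoints are excluded by `hr0`. -/
lemma pi_exists_forall_mem_Ioo_right (hl : Measurable l) (hr : Measurable r)
    (hlr : ∀ᵐ x ∂ν, l x < r x) (hr0 : ∀ t, ν {w | r w = t} = 0) :
    Measure.pi (fun _ : Fin (n + 1) => ν) {y | ∃ s, ∀ j, s ∈ Set.Ioo (l (y j)) (r (y j))} =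
      (n + 1) * ∫⁻ x, ν {w | r x ∈ Set.Ioo (l w) (r w)} ^ n ∂ν :=
  (pi_exists_forall_mem_Ioo_le hl hr hr0).antisymm (le_pi_exists_forall_mem_Ioo hl hr hlr)

lemma pi_exists_forall_mem_Ioo_left (hl : Measurable l) (hr : Measurable r)
    (hlr : ∀ᵐ x ∂ν, l x < r x) (hl0 : ∀ t, ν {w | l w = t} = 0) :
    Measure.pi (fun _ : Fin (n + 1) => ν) {y | ∃ s, ∀ j, s ∈ Set.Ioo (l (y j)) (r (y j))} =
      (n + 1) * ∫⁻ x, ν {w | l x ∈ Set.Ioo (l w) (r w)} ^ n ∂ν := by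
  have h := pi_exists_forall_mem_Ioo_right (ν := ν) (n := n) hr.neg hl.neg
    (hlr.mono fun x hx => neg_lt_neg hx) fun t => by
      simpa only [Pi.neg_apply, neg_eq_iff_eq_neg] using (hl0 (-t))
  simp only [Pi.neg_apply, ← Set.neg_mem_Ioo_iff, neg_neg] at h
  rw [← h]
  congr 1
  ext y
  exact ⟨fun ⟨s, hs⟩ => ⟨-s, by simpa using hs⟩, fun ⟨s, hs⟩ => ⟨-s, hs⟩⟩

end RandomIntervals

section Strip

lemma addHaar_setOf_linearMap_eq {E : Type*} [NormedAddCommGroup E] [NormedSpace ℝ E]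
    [FiniteDimensional ℝ E] [MeasurableSpace E] [BorelSpace E] (μ : Measure E)
    [μ.IsAddHaarMeasure] {f : E →ₗ[ℝ] ℝ} (hf : f ≠ 0) (t : ℝ) : μ {x | f x = t} = 0 := by
  obtain ⟨κ, -, hκ⟩ := f.exists_map_addHaar_eq_smul_addHaar μ volume (f.surjective hf)
  have hmeas : Measurable f := f.continuous_of_finiteDimensional.measurable
  change μ (f ⁻¹' {t}) = 0
  rw [← Measure.map_apply hmeas (measurableSet_singleton t), hκ]
  simp

/-- The signed area of the parallelogram spanned by two vectors of the plane, as a linear form in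
the second one. -/
def areaForm (z : ℝ × ℝ) : ℝ × ℝ →ₗ[ℝ] ℝ := z.1 • LinearMap.snd ℝ ℝ ℝ - z.2 • LinearMap.fst ℝ ℝ ℝ

lemma areaForm_apply (z w : ℝ × ℝ) : areaForm z w = z.1 * w.2 - z.2 * w.1 := rfl

/-- The open strip bounded by the line through `z` and `y` and the opposite line, through `-z` and
`-y`. -/
def strip (z y : ℝ × ℝ) : Set (ℝ × ℝ) := {w | |areaForm w (y - z)| < |areaForm z y|}

/-- The linear forms with value `1` at `z ≠ 0`, parametrized by `s`. -/
noncomputable def normalizedForm (z : ℝ × ℝ) (s : ℝ) : ℝ × ℝ →ₗ[ℝ] ℝ :=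
  (z.1 ^ 2 + z.2 ^ 2)⁻¹ • (z.1 • LinearMap.fst ℝ ℝ ℝ + z.2 • LinearMap.snd ℝ ℝ ℝ) + s • areaForm z

lemma normalizedForm_apply (z : ℝ × ℝ) (s : ℝ) (w : ℝ × ℝ) :
    normalizedForm z s w = (z.1 ^ 2 + z.2 ^ 2)⁻¹ * (z.1 * w.1 + z.2 * w.2) + s * areaForm z w := rfl

lemma measurableSet_strip :
    MeasurableSet {p : ((ℝ × ℝ) × (ℝ × ℝ)) × (ℝ × ℝ) | p.2 ∈ strip p.1.1 p.1.2} := by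
  simp only [strip, areaForm_apply, Set.mem_ofPred_eq]
  exact measurableSet_lt (by fun_prop) (by fun_prop)

section NormalizedForm

variable {z : ℝ × ℝ} (hz : z ≠ 0)

include hz

lemma sq_add_sq_ne_zero_of_ne_zero : z.1 ^ 2 + z.2 ^ 2 ≠ 0 := by
  contrapose! hz
  ext
  · simp; nlinarith [sq_nonneg z.1, sq_nonneg z.2]
  · simp; nlinarith [sq_nonneg z.1, sq_nonneg z.2]

lemma normalizedForm_self (s : ℝ) : normalizedForm z s z = 1 := by
  have := sq_add_sq_ne_zero_of_ne_zero hz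
  rw [normalizedForm_apply, areaForm_apply]
  field_simp
  ring

lemma exists_eq_mul_normalizedForm (f : ℝ × ℝ →ₗ[ℝ] ℝ) (hf : f z ≠ 0) :
    ∃ s, ∀ w, f w = f z * normalizedForm z s w := by
  have hsq := sq_add_sq_ne_zero_of_ne_zero hz
  refine ⟨(z.1 ^ 2 + z.2 ^ 2)⁻¹ * f (-z.2, z.1) / f z, fun w => ?_⟩
  have hw : (z.1 ^ 2 + z.2 ^ 2) • w = (z.1 * w.1 + z.2 * w.2) • z + areaForm z w • (-z.2, z.1) := by
    ext <;> simp [areaForm_apply] <;> ring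
  have hfw := congrArg f hw
  simp only [map_add, map_smul, smul_eq_mul] at hfw
  rw [normalizedForm_apply]
  field_simp
  linarith

lemma exists_forall_abs_lt_iff_exists_normalizedForm {ι : Type*} [Nonempty ι] {y : ι → ℝ × ℝ} :
    (∃ f : ℝ × ℝ →L[ℝ] ℝ, ∀ i, |f (y i)| < |f z|) ↔
      ∃ s, ∀ i, |normalizedForm z s (y i)| < 1 := by
  constructor
  · rintro ⟨f, hf⟩
    have hfz : 0 < |f z| := (abs_nonneg _).trans_lt (hf (Classical.arbitrary ι))
    obtain ⟨s, hs⟩ := exists_eq_mul_normalizedForm hz f.toLinearMap (abs_pos.mp hfz)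
    refine ⟨s, fun i => ?_⟩
    have hi : |f z| * |normalizedForm z s (y i)| < |f z| := by
      rw [← abs_mul]
      exact hs (y i) ▸ hf i
    nlinarith
  · rintro ⟨s, hs⟩
    refine ⟨LinearMap.toContinuousLinearMap (normalizedForm z s), fun i => ?_⟩
    simpa only [LinearMap.coe_toContinuousLinearMap', normalizedForm_self hz, abs_one] using hs i

lemma normalizedForm_mul_areaForm {s : ℝ} {y : ℝ × ℝ} (hy : normalizedForm z s y = 1) (w : ℝ × ℝ) :
    normalizedForm z s w * areaForm z y = areaForm w (y - z) := by
  have hw : areaForm z y • w = areaForm w y • z + areaForm z w • y := by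
    ext <;> simp [areaForm_apply] <;> ring
  have h := congrArg (normalizedForm z s) hw
  simp only [map_add, map_smul, smul_eq_mul, normalizedForm_self hz, hy] at h
  simp only [areaForm_apply, Prod.fst_sub, Prod.snd_sub] at h ⊢
  linarith

lemma setOf_abs_normalizedForm_lt_one {s : ℝ} {y : ℝ × ℝ} (hzy : areaForm z y ≠ 0)
    (hy : normalizedForm z s y = 1) : {w | |normalizedForm z s w| < 1} = strip z y := by
  ext w
  rw [strip, Set.mem_ofPred_eq, Set.mem_ofPred_eq, ← normalizedForm_mul_areaForm hz hy, abs_mul]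
  exact (mul_lt_iff_lt_one_left (abs_pos.mpr hzy)).symm

end NormalizedForm

/-- The lower end of the interval of those `s` with `|normalizedForm z s w| < 1`. -/
noncomputable def formLower (z w : ℝ × ℝ) : ℝ :=
  -normalizedForm z 0 w / areaForm z w - |areaForm z w|⁻¹

/-- The upper end of the interval of those `s` with `|normalizedForm z s w| < 1`. -/
noncomputable def formUpper (z w : ℝ × ℝ) : ℝ :=
  -normalizedForm z 0 w / areaForm z w + |areaForm z w|⁻¹

lemma measurable_formLower (z : ℝ × ℝ) : Measurable (formLower z) := by
  unfold formLower
  simp only [normalizedForm_apply, areaForm_apply]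
  fun_prop

lemma measurable_formUpper (z : ℝ × ℝ) : Measurable (formUpper z) := by
  unfold formUpper
  simp only [normalizedForm_apply, areaForm_apply]
  fun_prop

lemma normalizedForm_eq_add (z : ℝ × ℝ) (s : ℝ) (w : ℝ × ℝ) :
    normalizedForm z s w = normalizedForm z 0 w + s * areaForm z w := by
  simp only [normalizedForm_apply, zero_mul, add_zero]

section Endpoints

variable {z w : ℝ × ℝ} (hzw : areaForm z w ≠ 0)

include hzw

lemma formLower_lt_formUpper : formLower z w < formUpper z w := by
  have : 0 < |areaForm z w|⁻¹ := inv_pos.mpr (abs_pos.mpr hzw)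
  unfold formLower formUpper
  linarith

lemma abs_normalizedForm_lt_one_iff {s : ℝ} :
    |normalizedForm z s w| < 1 ↔ s ∈ Set.Ioo (formLower z w) (formUpper z w) := by
  have h : normalizedForm z s w = (s - -normalizedForm z 0 w / areaForm z w) * areaForm z w := by
    rw [normalizedForm_eq_add]
    field_simp
    ring
  rw [h, abs_mul, ← lt_div_iff₀ (abs_pos.mpr hzw), one_div, formLower, formUpper,
    abs_lt]
  exact ⟨fun hs => ⟨by linarith [hs.1], by linarith [hs.2]⟩,
    fun hs => ⟨by linarith [hs.1], by linarith [hs.2]⟩⟩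

lemma normalizedForm_formLower :
    normalizedForm z (formLower z w) w = -(areaForm z w / |areaForm z w|) := by
  rw [normalizedForm_eq_add, formLower]
  field_simp
  ring

lemma normalizedForm_formUpper :
    normalizedForm z (formUpper z w) w = areaForm z w / |areaForm z w| := by
  rw [normalizedForm_eq_add, formUpper]
  field_simp
  ring

end Endpoints

section MissProbability

variable {ν : Measure (ℝ × ℝ)} (hν : ν ≪ volume) {z : ℝ × ℝ} (hz : z ≠ 0)

include hν hz

lemma ae_areaForm_ne_zero : ∀ᵐ w ∂ν, areaForm z w ≠ 0 := by
  have hne : areaForm z ≠ 0 := by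
    intro h
    have h1 := DFunLike.congr_fun h (1, 0)
    have h2 := DFunLike.congr_fun h (0, 1)
    simp only [areaForm_apply, LinearMap.zero_apply] at h1 h2
    exact hz (Prod.ext (by simpa using h2) (by simpa using h1))
  exact hν.ae_le (compl_mem_ae_iff.mpr (addHaar_setOf_linearMap_eq volume hne 0))

lemma measure_setOf_abs_normalizedForm_eq_one (s : ℝ) :
    ν {w | |normalizedForm z s w| = 1} = 0 := by
  have hne : normalizedForm z s ≠ 0 := fun h => by
    simpa only [h, LinearMap.zero_apply, zero_ne_one] using normalizedForm_self hz s
  refine hν (measure_mono_null ?_ (measure_union_null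
    (addHaar_setOf_linearMap_eq volume hne 1) (addHaar_setOf_linearMap_eq volume hne (-1))))
  exact fun w hw => eq_or_eq_neg_of_abs_eq hw

lemma measure_setOf_formLower_eq (t : ℝ) : ν {w | formLower z w = t} = 0 := by
  refine measure_mono_null_ae ?_ (measure_setOf_abs_normalizedForm_eq_one hν hz t)
  filter_upwards [ae_areaForm_ne_zero hν hz] with w hw ht
  obtain rfl : formLower z w = t := ht
  change |normalizedForm z _ w| = 1
  rw [normalizedForm_formLower hw, abs_neg, abs_div, abs_abs, div_self (abs_ne_zero.mpr hw)]

lemma measure_setOf_formUpper_eq (t : ℝ) : ν {w | formUpper z w = t} = 0 := by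
  refine measure_mono_null_ae ?_ (measure_setOf_abs_normalizedForm_eq_one hν hz t)
  filter_upwards [ae_areaForm_ne_zero hν hz] with w hw ht
  obtain rfl : formUpper z w = t := ht
  change |normalizedForm z _ w| = 1
  rw [normalizedForm_formUpper hw, abs_div, abs_abs, div_self (abs_ne_zero.mpr hw)]

lemma measure_setOf_mem_Ioo_form (s : ℝ) :
    ν {w | s ∈ Set.Ioo (formLower z w) (formUpper z w)} =
      ν {w | |normalizedForm z s w| < 1} := by
  refine measure_congr ?_
  filter_upwards [ae_areaForm_ne_zero hν hz] with w hw
  exact propext (abs_normalizedForm_lt_one_iff hw).symm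

lemma measure_Ioo_formLower_add_formUpper (n : ℕ) {y : ℝ × ℝ} (hzy : areaForm z y ≠ 0) :
    ν {w | formUpper z y ∈ Set.Ioo (formLower z w) (formUpper z w)} ^ n +
        ν {w | formLower z y ∈ Set.Ioo (formLower z w) (formUpper z w)} ^ n =
      ν (strip z y) ^ n + ν (strip z (-y)) ^ n := by
  have hzy' : areaForm z (-y) ≠ 0 := by rwa [map_neg, neg_ne_zero]
  rw [measure_setOf_mem_Ioo_form hν hz, measure_setOf_mem_Ioo_form hν hz]
  have hU := normalizedForm_formUpper hzy
  have hL := normalizedForm_formLower hzy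
  rcases lt_or_gt_of_ne hzy with hneg | hpos
  · rw [abs_of_neg hneg, div_neg, div_self hzy] at hU hL
    rw [setOf_abs_normalizedForm_lt_one hz hzy' (by rw [map_neg, hU, neg_neg]),
      setOf_abs_normalizedForm_lt_one hz hzy (by rw [hL, neg_neg]), add_comm]
  · rw [abs_of_pos hpos, div_self hzy] at hU hL
    rw [setOf_abs_normalizedForm_lt_one hz hzy hU,
      setOf_abs_normalizedForm_lt_one hz hzy' (by rw [map_neg, hL, neg_neg])]

variable [SigmaFinite ν] {n : ℕ}

lemma pi_notMem_absConvexHull_range_eq_pi_Ioo :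
    Measure.pi (fun _ : Fin (n + 1) => ν) {y | z ∉ absConvexHull ℝ (Set.range y)} =
      Measure.pi (fun _ : Fin (n + 1) => ν)
        {y | ∃ s, ∀ j, s ∈ Set.Ioo (formLower z (y j)) (formUpper z (y j))} := by
  have hall : ∀ᵐ y ∂Measure.pi fun _ : Fin (n + 1) => ν, ∀ j, areaForm z (y j) ≠ 0 :=
    ae_all_iff.mpr fun j => (Measure.tendsto_eval_ae_ae (μ := fun _ => ν) (i := j)).eventually
      (ae_areaForm_ne_zero hν hz)
  refine measure_congr ?_
  filter_upwards [hall] with y hy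
  refine propext ?_
  change z ∉ absConvexHull ℝ (Set.range y) ↔ _
  rw [notMem_absConvexHull_range_iff, exists_forall_abs_lt_iff_exists_normalizedForm hz]
  exact exists_congr fun s => forall_congr' fun j => abs_normalizedForm_lt_one_iff (hy j)

variable [ν.IsNegInvariant]

/-- The forms with value `1` at `z` and absolute value less than `1` at every point `y j` make up
an open interval. Either end of it is attained at a form equal to `1` at some `± y j`, which says
that the strip through `z` and `± y j` contains the other points. -/
theorem pi_notMem_absConvexHull_range :
    Measure.pi (fun _ : Fin (n + 1) => ν) {y | z ∉ absConvexHull ℝ (Set.range y)} =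
      (n + 1) * ∫⁻ y, ν (strip z y) ^ n ∂ν := by
  have hlt : ∀ᵐ y ∂ν, formLower z y < formUpper z y :=
    (ae_areaForm_ne_zero hν hz).mono fun y => formLower_lt_formUpper
  have hL := measurable_formLower z
  have hU := measurable_formUpper z
  have hstrip : Measurable fun y => ν (strip z y) ^ n :=
    (measurable_measure_prodMk_left (measurableSet_strip.preimage
      (f := fun p : (ℝ × ℝ) × (ℝ × ℝ) => ((z, p.1), p.2)) (by fun_prop))).pow_const n
  have hmeas : Measurable fun y =>
      ν {w | formUpper z y ∈ Set.Ioo (formLower z w) (formUpper z w)} ^ n :=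
    (measurable_measure_prodMk_left
      ((measurableSet_lt (hL.comp measurable_snd) (hU.comp measurable_fst)).inter
        (measurableSet_lt (hU.comp measurable_fst) (hU.comp measurable_snd)))).pow_const n
  have hkey : 2 * Measure.pi (fun _ : Fin (n + 1) => ν) {y | z ∉ absConvexHull ℝ (Set.range y)} =
      2 * ((n + 1) * ∫⁻ y, ν (strip z y) ^ n ∂ν) := by
    calc _ = (n + 1) * ∫⁻ y,
          (ν {w | formUpper z y ∈ Set.Ioo (formLower z w) (formUpper z w)} ^ n +
            ν {w | formLower z y ∈ Set.Ioo (formLower z w) (formUpper z w)} ^ n) ∂ν := by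
          rw [two_mul, pi_notMem_absConvexHull_range_eq_pi_Ioo hν hz, lintegral_add_left hmeas,
            mul_add, ← pi_exists_forall_mem_Ioo_right hL hU hlt (measure_setOf_formUpper_eq hν hz),
            ← pi_exists_forall_mem_Ioo_left hL hU hlt (measure_setOf_formLower_eq hν hz)]
      _ = (n + 1) * ∫⁻ y, (ν (strip z y) ^ n + ν (strip z (-y)) ^ n) ∂ν := by
          congr 1
          exact lintegral_congr_ae ((ae_areaForm_ne_zero hν hz).mono fun y =>
            measure_Ioo_formLower_add_formUpper hν hz n)
      _ = _ := by
          rw [lintegral_add_left hstrip, lintegral_neg_eq_self fun y => ν (strip z y) ^ n]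
          ring
  exact (ENNReal.mul_right_inj two_ne_zero ENNReal.ofNat_ne_top).mp hkey

end MissProbability

lemma lintegral_measure_compl_absConvexHull_range {ν : Measure (ℝ × ℝ)} (hν : ν ≪ volume)
    [SigmaFinite ν] [ν.IsNegInvariant] (n : ℕ) :
    ∫⁻ y, ν (absConvexHull ℝ (Set.range y))ᶜ ∂(Measure.pi fun _ : Fin (n + 1) => ν) =
      (n + 1) * ∫⁻ z, ∫⁻ y, ν (strip z y) ^ n ∂ν ∂ν := by
  have hopen := isOpen_setOf_notMem_absConvexHull_range (E := ℝ × ℝ) (ι := Fin (n + 1))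
  have hz : ∀ᵐ z ∂ν, z ≠ 0 := hν.ae_le (compl_mem_ae_iff.mpr (measure_singleton 0))
  calc _ = ∫⁻ z, Measure.pi (fun _ : Fin (n + 1) => ν)
          {y | z ∉ absConvexHull ℝ (Set.range y)} ∂ν :=
        (Measure.prod_apply hopen.measurableSet).symm.trans
          (Measure.prod_apply_symm hopen.measurableSet)
    _ = ∫⁻ z, (n + 1) * ∫⁻ y, ν (strip z y) ^ n ∂ν ∂ν :=
        lintegral_congr_ae (hz.mono fun _ hz => pi_notMem_absConvexHull_range hν hz)
    _ = _ := by
        rw [lintegral_const_mul' _ _ (by finiteness)]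

end Strip

section LineCoordinates

lemma lintegral_lintegral_prod_prod_comm {α β γ δ : Type*} [MeasurableSpace α]
    [MeasurableSpace β] [MeasurableSpace γ] [MeasurableSpace δ] {μ : Measure α} {ν : Measure β}
    {μ' : Measure γ} {ν' : Measure δ} [SFinite ν] [SFinite μ'] [SFinite ν']
    {f : (α × γ) × (β × δ) → ENNReal} (hf : Measurable f) :
    ∫⁻ z, ∫⁻ y, f ((z.1, y.1), (z.2, y.2)) ∂(μ'.prod ν') ∂(μ.prod ν) =
      ∫⁻ p, ∫⁻ q, f (p, q) ∂(ν.prod ν') ∂(μ.prod μ') := by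
  calc ∫⁻ z, ∫⁻ y, f ((z.1, y.1), (z.2, y.2)) ∂(μ'.prod ν') ∂(μ.prod ν)
      = ∫⁻ a, ∫⁻ b, ∫⁻ c, ∫⁻ d, f ((a, c), (b, d)) ∂ν' ∂μ' ∂ν ∂μ := by
        rw [lintegral_prod _ (Measurable.lintegral_prod_right' (f := fun p : (α × β) × (γ × δ) =>
          f ((p.1.1, p.2.1), (p.1.2, p.2.2))) (by fun_prop)).aemeasurable]
        exact lintegral_congr fun a => lintegral_congr fun b => lintegral_prod _ (by fun_prop)
    _ = ∫⁻ a, ∫⁻ c, ∫⁻ b, ∫⁻ d, f ((a, c), (b, d)) ∂ν' ∂ν ∂μ' ∂μ :=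
        lintegral_congr fun a => lintegral_lintegral_swap (Measurable.lintegral_prod_right'
          (f := fun p : (β × γ) × δ => f ((a, p.1.2), (p.1.1, p.2))) (by fun_prop)).aemeasurable
    _ = ∫⁻ p, ∫⁻ q, f (p, q) ∂(ν.prod ν') ∂(μ.prod μ') := by
        rw [lintegral_prod _ hf.lintegral_prod_right'.aemeasurable]
        exact lintegral_congr fun a => lintegral_congr fun c =>
          (lintegral_prod (fun q => f ((a, c), q)) (by fun_prop)).symm

lemma lintegral_eq_lintegral_line {x₁ x₂ : ℝ} (hx : x₁ ≠ x₂) {g : ℝ × ℝ → ENNReal}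
    (hg : Measurable g) :
    ∫⁻ u, g u = ENNReal.ofReal |x₂ - x₁| *
      ∫⁻ q : ℝ × ℝ, g (q.2 + q.1 * x₁, q.2 + q.1 * x₂) := by
  let L := Matrix.toLin (Module.Basis.finTwoProd ℝ) (Module.Basis.finTwoProd ℝ) !![x₁, 1; x₂, 1]
  have hL : ∀ q, L q = (q.2 + q.1 * x₁, q.2 + q.1 * x₂) := fun q => by
    rw [Matrix.toLin_finTwoProd_apply]
    ext <;> simp only <;> ring
  have hdet : LinearMap.det L = x₁ - x₂ := by
    rw [LinearMap.det_toLin, Matrix.det_fin_two_of, one_mul, mul_one]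
  have hne : x₁ - x₂ ≠ 0 := sub_ne_zero.mpr hx
  have hLm : Measurable L := L.continuous_of_finiteDimensional.measurable
  simp only [← hL]
  rw [← lintegral_map hg hLm, Measure.map_linearMap_addHaar_eq_smul_addHaar volume
    (by rwa [hdet]), lintegral_smul_measure, hdet, smul_eq_mul, ← mul_assoc,
    ← ENNReal.ofReal_mul (abs_nonneg _), abs_inv, abs_sub_comm, mul_inv_cancel₀ (by
      rwa [abs_ne_zero]), ENNReal.ofReal_one, one_mul]

/-- The integral of `f` over the pairs of points of the line `y = c + m x`, with the density
`|x₂ - x₁|` that pairs of points acquire when they are described by `c`, `m` and their abscissas. -/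
noncomputable def linePairIntegral (f : ℝ × ℝ → ℝ × ℝ → ENNReal) (c m : ℝ) : ENNReal :=
  ∫⁻ x : ℝ × ℝ, ENNReal.ofReal |x.2 - x.1| * f (x.1, c + m * x.1) (x.2, c + m * x.2)

variable {f : ℝ × ℝ → ℝ × ℝ → ENNReal}

lemma linePairIntegral_eq_mul {g : ℝ × ℝ → ℝ × ℝ → ENNReal} {c m : ℝ} {k : ENNReal} (hk : k ≠ ⊤)
    (h : ∀ x₁ x₂, x₁ ≠ x₂ →
      g (x₁, c + m * x₁) (x₂, c + m * x₂) = k * f (x₁, c + m * x₁) (x₂, c + m * x₂)) :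
    linePairIntegral g c m = k * linePairIntegral f c m := by
  rw [linePairIntegral, linePairIntegral, ← lintegral_const_mul' _ _ hk]
  refine lintegral_congr fun x => ?_
  obtain hx | hx := eq_or_ne x.1 x.2
  · simp [hx]
  · rw [h _ _ hx, mul_left_comm]

theorem lintegral_lintegral_eq_linePairIntegral (hf : Measurable (Function.uncurry f)) :
    ∫⁻ z, ∫⁻ y, f z y = ∫⁻ m, ∫⁻ c, linePairIntegral f c m := by
  have hcomp : ∀ {α : Type} [MeasurableSpace α] {a b : α → ℝ × ℝ}, Measurable a → Measurable b →
      Measurable fun x => f (a x) (b x) := fun ha hb => hf.comp (ha.prodMk hb)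
  have hjoint : Measurable fun p : (ℝ × ℝ) × (ℝ × ℝ) => ENNReal.ofReal |p.1.2 - p.1.1| *
      f (p.1.1, p.2.2 + p.2.1 * p.1.1) (p.1.2, p.2.2 + p.2.1 * p.1.2) :=
    Measurable.mul (by fun_prop) (hcomp (by fun_prop) (by fun_prop))
  have hne : ∀ᵐ x : ℝ × ℝ, x.1 ≠ x.2 := by
    have hf : LinearMap.fst ℝ ℝ ℝ - LinearMap.snd ℝ ℝ ℝ ≠ 0 := fun h => by
      simpa using DFunLike.congr_fun h (1, 0)
    filter_upwards [compl_mem_ae_iff.mpr (addHaar_setOf_linearMap_eq volume hf 0)] with x hx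
    exact fun h => hx (sub_eq_zero.mpr h)
  calc ∫⁻ z, ∫⁻ y, f z y
      = ∫⁻ x : ℝ × ℝ, ∫⁻ u : ℝ × ℝ, f (x.1, u.1) (x.2, u.2) :=
        lintegral_lintegral_prod_prod_comm (f := fun p : (ℝ × ℝ) × (ℝ × ℝ) =>
          f (p.1.1, p.2.1) (p.1.2, p.2.2)) (hcomp (by fun_prop) (by fun_prop))
    _ = ∫⁻ x : ℝ × ℝ, ∫⁻ q : ℝ × ℝ, ENNReal.ofReal |x.2 - x.1| *
          f (x.1, q.2 + q.1 * x.1) (x.2, q.2 + q.1 * x.2) := by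
        refine lintegral_congr_ae (hne.mono fun x hx => ?_)
        refine Eq.trans ?_ (lintegral_const_mul' _ _ ENNReal.ofReal_ne_top).symm
        exact lintegral_eq_lintegral_line hx (hcomp (by fun_prop) (by fun_prop))
    _ = ∫⁻ q : ℝ × ℝ, linePairIntegral f q.2 q.1 := lintegral_lintegral_swap hjoint.aemeasurable
    _ = ∫⁻ m, ∫⁻ c, linePairIntegral f c m := by
        rw [Measure.volume_eq_prod, lintegral_prod _ (Measurable.aemeasurable ?_)]
        exact (hjoint.comp measurable_swap).lintegral_prod_right'

lemma lintegral_eq_two_mul_of_even {g : ℝ → ENNReal} (hg : ∀ x, g (-x) = g x) :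
    ∫⁻ x, g x = 2 * ∫⁻ x in Set.Ioi 0, g x := by
  have h : ∫⁻ x in Set.Iic 0, g x = ∫⁻ x in Set.Ioi 0, g x := by
    rw [← lintegral_indicator measurableSet_Iic, ← lintegral_neg_eq_self,
      setLIntegral_congr (Ioi_ae_eq_Ici (a := (0 : ℝ))), ← lintegral_indicator measurableSet_Ici]
    refine lintegral_congr fun x => ?_
    simp only [Set.indicator_apply, Set.mem_Iic, Left.neg_nonpos_iff, Set.mem_Ici, hg]
  rw [← lintegral_add_compl g (measurableSet_Ioi (a := (0 : ℝ))), Set.compl_Ioi, h, two_mul]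

lemma linePairIntegral_neg_intercept_neg_slope
    (hsnd : ∀ z y, f (z.1, -z.2) (y.1, -y.2) = f z y) (c m : ℝ) :
    linePairIntegral f (-c) (-m) = linePairIntegral f c m := by
  refine lintegral_congr fun x => ?_
  rw [← hsnd]
  congr 3 <;> ring

lemma linePairIntegral_neg_slope (hfst : ∀ z y, f (-z.1, z.2) (-y.1, y.2) = f z y) (c m : ℝ) :
    linePairIntegral f c (-m) = linePairIntegral f c m := by
  rw [linePairIntegral, ← lintegral_neg_eq_self]
  refine lintegral_congr fun x => ?_
  have h := hfst (x.1, c + m * x.1) (x.2, c + m * x.2)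
  simp only [Prod.fst_neg, Prod.snd_neg, neg_mul_neg] at h ⊢
  rw [h, neg_sub_neg, abs_sub_comm]

lemma lintegral_lintegral_indicator_eq_setLIntegral_slope (hf : Measurable (Function.uncurry f))
    {s : Set ((ℝ × ℝ) × (ℝ × ℝ))} (hs : MeasurableSet s) {t : Set ℝ} (ht : MeasurableSet t)
    (hst : ∀ c m x₁ x₂, x₁ ≠ x₂ → (((x₁, c + m * x₁), (x₂, c + m * x₂)) ∈ s ↔ m ∈ t)) :
    ∫⁻ z, ∫⁻ y, s.indicator (Function.uncurry f) (z, y) =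
      ∫⁻ m in t, ∫⁻ c, linePairIntegral f c m := by
  rw [lintegral_lintegral_eq_linePairIntegral (f := fun z y => s.indicator _ (z, y))
    (hf.indicator hs), ← lintegral_indicator ht]
  refine lintegral_congr fun m => ?_
  by_cases hm : m ∈ t
  · rw [Set.indicator_of_mem hm]
    refine lintegral_congr fun c => (linePairIntegral_eq_mul ENNReal.one_ne_top ?_).trans
      (one_mul _)
    intro x₁ x₂ hx
    rw [Set.indicator_of_mem ((hst c m x₁ x₂ hx).mpr hm), one_mul, Function.uncurry_apply_pair]
  · rw [Set.indicator_of_notMem hm]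
    refine (lintegral_congr fun c => ?_).trans lintegral_zero
    refine (linePairIntegral_eq_mul (f := f) ENNReal.zero_ne_top ?_).trans (zero_mul _)
    intro x₁ x₂ hx
    rw [Set.indicator_of_notMem (mt (hst c m x₁ x₂ hx).mp hm), zero_mul]

lemma abs_sub_line (c m x₁ x₂ : ℝ) : |(c + m * x₂) - (c + m * x₁)| = |m| * |x₂ - x₁| := by
  rw [← abs_mul]
  congr 1
  ring

lemma lintegral_lintegral_indicator_add_compl {α β : Type*} [MeasurableSpace α]
    [MeasurableSpace β] {μ : Measure α} {ν : Measure β} [SFinite ν] {g : α × β → ENNReal}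
    (hg : Measurable g) {s : Set (α × β)} (hs : MeasurableSet s) :
    ∫⁻ x, ∫⁻ y, s.indicator g (x, y) ∂ν ∂μ + ∫⁻ x, ∫⁻ y, sᶜ.indicator g (x, y) ∂ν ∂μ =
      ∫⁻ x, ∫⁻ y, g (x, y) ∂ν ∂μ := by
  rw [← lintegral_add_left (hg.indicator hs).lintegral_prod_right']
  refine lintegral_congr fun x => ?_
  have hx : Measurable fun y => s.indicator g (x, y) :=
    (hg.indicator hs).comp measurable_prodMk_left
  rw [← lintegral_add_left hx]
  exact lintegral_congr fun y => Set.indicator_self_add_compl_apply s g (x, y)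

lemma lintegral_lintegral_comp_swap {α β : Type*} [MeasureSpace α] [MeasureSpace β]
    [SFinite (volume : Measure α)] [SFinite (volume : Measure β)] (g : α × β → α × β → ENNReal) :
    ∫⁻ z : β × α, ∫⁻ y : β × α, g z.swap y.swap = ∫⁻ z, ∫⁻ y, g z y := by
  have hswap : ∀ h : α × β → ENNReal, ∫⁻ z : β × α, h z.swap = ∫⁻ z, h z := fun h =>
    Measure.measurePreserving_swap.lintegral_comp_emb
      MeasurableEquiv.prodComm.measurableEmbedding h
  rw [← hswap]
  exact lintegral_congr fun z => hswap _

lemma lintegral_lintegral_eq_two_mul_setLIntegral_slope (hf : Measurable (Function.uncurry f))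
    (hswap : ∀ z y, f z.swap y.swap = f z y) :
    ∫⁻ z, ∫⁻ y, f z y = 2 * ∫⁻ m in Set.Icc (-1) 1, ∫⁻ c, linePairIntegral f c m := by
  let flat : Set ((ℝ × ℝ) × (ℝ × ℝ)) := {p | |p.2.2 - p.1.2| ≤ |p.2.1 - p.1.1|}
  let flatter : Set ((ℝ × ℝ) × (ℝ × ℝ)) := {p | |p.2.2 - p.1.2| < |p.2.1 - p.1.1|}
  have hflat : MeasurableSet flat := measurableSet_le (by fun_prop) (by fun_prop)
  have hflatter : MeasurableSet flatter := measurableSet_lt (by fun_prop) (by fun_prop)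
  have hIcc : ∫⁻ z, ∫⁻ y, flat.indicator (Function.uncurry f) (z, y) =
      ∫⁻ m in Set.Icc (-1) 1, ∫⁻ c, linePairIntegral f c m :=
    lintegral_lintegral_indicator_eq_setLIntegral_slope hf hflat measurableSet_Icc
      fun c m x₁ x₂ hx => by
        change |(c + m * x₂) - (c + m * x₁)| ≤ |x₂ - x₁| ↔ _
        rw [abs_sub_line, mul_le_iff_le_one_left (abs_pos.mpr (sub_ne_zero.mpr hx.symm)), abs_le,
          Set.mem_Icc]
  have hIoo : ∫⁻ z, ∫⁻ y, flatter.indicator (Function.uncurry f) (z, y) =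
      ∫⁻ m in Set.Ioo (-1) 1, ∫⁻ c, linePairIntegral f c m :=
    lintegral_lintegral_indicator_eq_setLIntegral_slope hf hflatter measurableSet_Ioo
      fun c m x₁ x₂ hx => by
        change |(c + m * x₂) - (c + m * x₁)| < |x₂ - x₁| ↔ _
        rw [abs_sub_line, mul_lt_iff_lt_one_left (abs_pos.mpr (sub_ne_zero.mpr hx.symm)), abs_lt,
          Set.mem_Ioo]
  have hsteep : ∀ z y, flatᶜ.indicator (Function.uncurry f) (z, y) =
      flatter.indicator (Function.uncurry f) (z.swap, y.swap) := fun z y => by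
    have hiff : (z, y) ∈ flatᶜ ↔ (z.swap, y.swap) ∈ flatter := not_le (α := ℝ)
    simp only [Set.indicator_apply, Function.uncurry_apply_pair, hswap, hiff]
  refine (lintegral_lintegral_indicator_add_compl hf hflat).symm.trans ?_
  rw [hIcc, lintegral_congr fun z => lintegral_congr fun y => hsteep z y,
    lintegral_lintegral_comp_swap fun z y => flatter.indicator (Function.uncurry f) (z, y), hIoo,
    setLIntegral_congr Ioo_ae_eq_Icc, two_mul]

theorem lintegral_lintegral_eq_eight_mul (hf : Measurable (Function.uncurry f))
    (hswap : ∀ z y, f z.swap y.swap = f z y) (hfst : ∀ z y, f (-z.1, z.2) (-y.1, y.2) = f z y)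
    (hsnd : ∀ z y, f (z.1, -z.2) (y.1, -y.2) = f z y) :
    ∫⁻ z, ∫⁻ y, f z y =
      8 * ∫⁻ m in Set.Ioc 0 1, ∫⁻ c in Set.Ioi 0, linePairIntegral f c m := by
  have hneg : ∀ c m, linePairIntegral f (-c) m = linePairIntegral f c m := fun c m => by
    rw [← linePairIntegral_neg_slope hfst, linePairIntegral_neg_intercept_neg_slope hsnd]
  have heven : ∀ m, (Set.Icc (-1) 1).indicator (fun m => ∫⁻ c, linePairIntegral f c m) (-m) =
      (Set.Icc (-1) 1).indicator (fun m => ∫⁻ c, linePairIntegral f c m) m := fun m => by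
    simp only [Set.indicator_apply, linePairIntegral_neg_slope hfst, Set.neg_mem_Icc_iff, neg_neg]
  rw [lintegral_lintegral_eq_two_mul_setLIntegral_slope hf hswap,
    ← lintegral_indicator measurableSet_Icc, lintegral_eq_two_mul_of_even heven,
    setLIntegral_indicator measurableSet_Icc]
  have hset : Set.Icc (-1) 1 ∩ Set.Ioi 0 = Set.Ioc (0 : ℝ) 1 := by
    ext m
    simp only [Set.mem_inter_iff, Set.mem_Icc, Set.mem_Ioi, Set.mem_Ioc]
    exact ⟨fun h => ⟨h.2, h.1.2⟩, fun h => ⟨⟨by linarith [h.1], h.2⟩, h.1⟩⟩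
  have hhalf : ∀ m, ∫⁻ c, linePairIntegral f c m =
      2 * ∫⁻ c in Set.Ioi 0, linePairIntegral f c m := fun m =>
    lintegral_eq_two_mul_of_even fun c => hneg c m
  rw [hset, lintegral_congr hhalf, lintegral_const_mul' _ _ ENNReal.ofNat_ne_top]
  ring

end LineCoordinates

section RealIntegrals

lemma lintegral_Ioc_ofReal_eq_sub {g G : ℝ → ℝ} {a b : ℝ} (hab : a ≤ b)
    (hG : ∀ x ∈ Set.Icc a b, HasDerivAt G (g x) x) (hg : ContinuousOn g (Set.Icc a b))
    (hpos : ∀ x ∈ Set.Icc a b, 0 ≤ g x) :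
    ∫⁻ x in Set.Ioc a b, ENNReal.ofReal (g x) = ENNReal.ofReal (G b - G a) := by
  have hint : IntervalIntegrable g volume a b :=
    ContinuousOn.intervalIntegrable (by rwa [Set.uIcc_of_le hab])
  rw [← intervalIntegral.integral_eq_sub_of_hasDerivAt (by rwa [Set.uIcc_of_le hab]) hint,
    intervalIntegral.integral_of_le hab, ofReal_integral_eq_lintegral_ofReal hint.1]
  filter_upwards [ae_restrict_mem measurableSet_Ioc] with x hx
  exact hpos x ⟨hx.1.le, hx.2⟩

lemma hasDerivAt_max_zero_sq (x : ℝ) :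
    HasDerivAt (fun x : ℝ => (max 0 x) ^ 2) (2 * max 0 x) x := by
  obtain hx | rfl | hx := lt_trichotomy x 0
  · rw [max_eq_left hx.le, mul_zero]
    refine (hasDerivAt_const x 0).congr_of_eventuallyEq ?_
    filter_upwards [gt_mem_nhds hx] with y hy
    rw [max_eq_left hy.le, zero_pow two_ne_zero]
  · rw [hasDerivAt_iff_isLittleO_nhds_zero]
    simp only [zero_add, max_self, mul_zero, smul_zero, sub_zero, zero_pow two_ne_zero]
    refine (Asymptotics.IsBigO.of_bound 1 (Filter.Eventually.of_forall fun h => ?_)).trans_isLittleO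
      (Asymptotics.isLittleO_pow_id one_lt_two)
    rw [one_mul, norm_pow, norm_pow, Real.norm_eq_abs, Real.norm_eq_abs]
    refine pow_le_pow_left₀ (abs_nonneg _) ?_ 2
    rw [abs_of_nonneg (le_max_left 0 h)]
    exact max_le (abs_nonneg h) (le_abs_self h)
  · rw [max_eq_right hx.le]
    refine (hasDerivAt_pow 2 x).congr_of_eventuallyEq ?_ |>.congr_deriv (by norm_num)
    filter_upwards [lt_mem_nhds hx] with y hy
    rw [max_eq_right hy.le]

lemma integral_max_zero_mul_add {m : ℝ} (hm : m ≠ 0) (a b d : ℝ) :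
    ∫ x in a..b, max 0 (m * x + d) = (max 0 (m * b + d) ^ 2 - max 0 (m * a + d) ^ 2) / (2 * m) := by
  have hderiv : ∀ x, HasDerivAt (fun x => max 0 (m * x + d) ^ 2 / (2 * m)) (max 0 (m * x + d)) x :=
    fun x => (((hasDerivAt_max_zero_sq _).comp x
      (((hasDerivAt_id' x).const_mul m).add_const d)).div_const (2 * m)).congr_deriv (by field_simp)
  rw [intervalIntegral.integral_eq_sub_of_hasDerivAt (fun x _ => hderiv x)
    (Continuous.intervalIntegrable (by fun_prop) _ _), sub_div]

lemma setLIntegral_Icc_abs_sub {a b x : ℝ} (hx : x ∈ Set.Icc a b) :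
    ∫⁻ y in Set.Icc a b, ENNReal.ofReal |y - x| =
      ENNReal.ofReal (((x - a) ^ 2 + (b - x) ^ 2) / 2) := by
  have hleft : ∫⁻ y in Set.Ioc a x, ENNReal.ofReal |y - x| = ENNReal.ofReal ((x - a) ^ 2 / 2) := by
    rw [setLIntegral_congr_fun measurableSet_Ioc (g := fun y => ENNReal.ofReal (x - y))
      fun y hy => by simp only [abs_of_nonpos (sub_nonpos.mpr hy.2), neg_sub],
      lintegral_Ioc_ofReal_eq_sub (G := fun y => -((x - y) ^ 2 / 2)) hx.1 (fun y _ => ?_)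
        (by fun_prop) fun y hy => sub_nonneg.mpr hy.2]
    · congr 1; ring
    · exact ((((hasDerivAt_id' y).const_sub x).pow 2).div_const 2).neg.congr_deriv
        (by norm_num; ring)
  have hright : ∫⁻ y in Set.Ioc x b, ENNReal.ofReal |y - x| =
      ENNReal.ofReal ((b - x) ^ 2 / 2) := by
    rw [setLIntegral_congr_fun measurableSet_Ioc (g := fun y => ENNReal.ofReal (y - x))
      fun y hy => by simp only [abs_of_nonneg (sub_nonneg.mpr hy.1.le)],
      lintegral_Ioc_ofReal_eq_sub (G := fun y => (y - x) ^ 2 / 2) hx.2 (fun y _ => ?_)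
        (by fun_prop) fun y hy => sub_nonneg.mpr hy.1]
    · congr 1; ring
    · exact ((((hasDerivAt_id' y).sub_const x).pow 2).div_const 2).congr_deriv (by norm_num)
  rw [setLIntegral_congr Ioc_ae_eq_Icc.symm, ← Set.Ioc_union_Ioc_eq_Ioc hx.1 hx.2,
    lintegral_union measurableSet_Ioc (Set.Ioc_disjoint_Ioc_of_le le_rfl), hleft, hright,
    add_div, ENNReal.ofReal_add (by positivity) (by positivity)]

lemma setLIntegral_Icc_prod_Icc_abs_sub {a b : ℝ} (hab : a ≤ b) :
    ∫⁻ x in Set.Icc a b ×ˢ Set.Icc a b, ENNReal.ofReal |x.2 - x.1| =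
      ENNReal.ofReal ((b - a) ^ 3 / 3) := by
  rw [Measure.volume_eq_prod, setLIntegral_prod _ (by fun_prop),
    setLIntegral_congr_fun measurableSet_Icc fun x hx => setLIntegral_Icc_abs_sub hx,
    setLIntegral_congr Ioc_ae_eq_Icc.symm,
    lintegral_Ioc_ofReal_eq_sub (G := fun x => ((x - a) ^ 3 - (b - x) ^ 3) / 6) hab
      (fun x _ => ?_) (by fun_prop) fun x _ => by positivity]
  · congr 1; ring
  · exact (((((hasDerivAt_id' x).sub_const a).pow 3).sub
      (((hasDerivAt_id' x).const_sub b).pow 3)).div_const 6).congr_deriv (by norm_num; ring)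

lemma add_two_mul_pow_add_one_le (n : ℕ) {q : ℝ} (hq : 0 ≤ q) :
    (n + 2) * q ^ (n + 1) ≤ 1 + (n + 1) * q ^ (n + 2) := by
  induction n with
  | zero => norm_num; nlinarith [sq_nonneg (q - 1)]
  | succ n ih =>
    have hsq : 0 ≤ (n + 2) * q ^ (n + 1) * (q - 1) ^ 2 := by positivity
    push_cast
    linear_combination ih + hsq

lemma setLIntegral_geom_sum_one_sub (n : ℕ) {k : ℝ} (hk : 0 ≤ k) :
    ∫⁻ m in Set.Ioc (0 : ℝ) 1, ENNReal.ofReal (k * ∑ j ∈ Finset.range n, (1 - m) ^ j) =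
      ENNReal.ofReal (k * ∑ j ∈ Finset.range n, 1 / ((j : ℝ) + 1)) := by
  rw [lintegral_Ioc_ofReal_eq_sub
    (G := fun m => -(k * ∑ j ∈ Finset.range n, (1 - m) ^ (j + 1) / (j + 1))) zero_le_one
    (fun m _ => ?_) (by fun_prop) fun m hm => ?_]
  · congr 1
    simp
  · refine ((HasDerivAt.fun_sum fun j _ => (((hasDerivAt_id' m).const_sub 1).pow (j + 1)).div_const
      ((j : ℝ) + 1)).const_mul k).neg.congr_deriv ?_
    rw [← mul_neg, ← Finset.sum_neg_distrib]
    congr 1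
    refine Finset.sum_congr rfl fun j _ => ?_
    push_cast
    field_simp
  · exact mul_nonneg hk (Finset.sum_nonneg fun j _ => pow_nonneg (sub_nonneg.mpr hm.2) j)

end RealIntegrals

section Square

/-- The square `[-1, 1]²`, the standard model of an origin-symmetric parallelogram. -/
def square : Set (ℝ × ℝ) := Set.Icc (-1) 1 ×ˢ Set.Icc (-1) 1

/-- The uniform distribution on the square `[-1, 1]²`. -/
noncomputable def squareUnif : Measure (ℝ × ℝ) := cond volume square

lemma measurableSet_square : MeasurableSet square := measurableSet_Icc.prod measurableSet_Icc

lemma volume_square : volume square = 4 := by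
  rw [square, Measure.volume_eq_prod, Measure.prod_prod, Real.volume_Icc,
    ← ENNReal.ofReal_mul (by norm_num)]
  norm_num

lemma squareUnif_eq : squareUnif = (4 : ENNReal)⁻¹ • volume.restrict square := by
  rw [squareUnif, ProbabilityTheory.cond, volume_square]

instance : IsProbabilityMeasure squareUnif :=
  cond_isProbabilityMeasure_of_finite (by rw [volume_square]; norm_num)
    (by rw [volume_square]; norm_num)

lemma squareUnif_apply (s : Set (ℝ × ℝ)) : squareUnif s = 4⁻¹ * volume (square ∩ s) := by
  rw [squareUnif, cond_apply measurableSet_square, volume_square]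

lemma squareUnif_absolutelyContinuous : squareUnif ≪ volume := cond_absolutelyContinuous

lemma lintegral_squareUnif (g : ℝ × ℝ → ENNReal) :
    ∫⁻ z, g z ∂squareUnif = 4⁻¹ * ∫⁻ z in square, g z := by
  rw [squareUnif_eq, lintegral_smul_measure, smul_eq_mul]

lemma measurePreserving_squareUnif {L : ℝ × ℝ → ℝ × ℝ} (hL : MeasurePreserving L)
    (hsq : L ⁻¹' square = square) : MeasurePreserving L squareUnif squareUnif := by
  have hr := hL.restrict_preimage measurableSet_square
  rw [hsq] at hr
  rw [squareUnif_eq]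
  exact ⟨hr.measurable, by rw [Measure.map_smul, hr.map_eq]⟩

instance : squareUnif.IsNegInvariant where
  neg_eq_self := (measurePreserving_squareUnif (Measure.measurePreserving_neg volume) (by
    ext z
    simp only [square, Set.mem_preimage, Set.mem_prod, Prod.fst_neg, Prod.snd_neg,
      Set.neg_mem_Icc_iff, neg_neg])).map_eq

lemma squareUnif_strip_comp {L : ℝ × ℝ → ℝ × ℝ} (hL : MeasurePreserving L)
    (hsq : L ⁻¹' square = square) (hsub : ∀ z y, L (y - z) = L y - L z)
    (harea : ∀ z y, |areaForm (L z) (L y)| = |areaForm z y|) (z y : ℝ × ℝ) :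
    squareUnif (strip (L z) (L y)) = squareUnif (strip z y) := by
  have hstrip : MeasurableSet (strip (L z) (L y)) :=
    measurable_prodMk_left (x := (L z, L y)) measurableSet_strip
  rw [← (measurePreserving_squareUnif hL hsq).measure_preimage hstrip.nullMeasurableSet]
  congr 1
  ext w
  change |areaForm (L w) (L y - L z)| < |areaForm (L z) (L y)| ↔ _
  rw [← hsub, harea, harea]
  rfl

lemma squareUnif_strip_swap (z y : ℝ × ℝ) :
    squareUnif (strip z.swap y.swap) = squareUnif (strip z y) := by
  refine squareUnif_strip_comp Measure.measurePreserving_swap (Set.preimage_swap_prod _ _)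
    (fun _ _ => rfl) (fun z y => ?_) z y
  rw [areaForm_apply, areaForm_apply, abs_sub_comm]
  simp only [Prod.fst_swap, Prod.snd_swap]

lemma squareUnif_strip_neg_fst (z y : ℝ × ℝ) :
    squareUnif (strip (-z.1, z.2) (-y.1, y.2)) = squareUnif (strip z y) := by
  refine squareUnif_strip_comp (L := Prod.map Neg.neg id)
    ((Measure.measurePreserving_neg volume).prod (MeasurePreserving.id volume)) ?_
    (fun z y => ?_) (fun z y => ?_) z y
  · ext z
    simp only [square, Set.mem_preimage, Set.mem_prod, Prod.map_fst, Prod.map_snd, id,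
      Set.neg_mem_Icc_iff, neg_neg]
  · ext <;> simp only [Prod.map_fst, Prod.map_snd, Prod.fst_sub, Prod.snd_sub, id]
    ring
  · rw [areaForm_apply, areaForm_apply, ← abs_neg]
    simp only [Prod.map_fst, Prod.map_snd, id]
    congr 1
    ring

lemma squareUnif_strip_neg_snd (z y : ℝ × ℝ) :
    squareUnif (strip (z.1, -z.2) (y.1, -y.2)) = squareUnif (strip z y) := by
  rw [← squareUnif_strip_swap, ← squareUnif_strip_swap z, ← squareUnif_strip_neg_fst z.swap]
  rfl

lemma strip_line {c m x₁ x₂ : ℝ} (hc : 0 ≤ c) (hx : x₁ ≠ x₂) :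
    strip (x₁, c + m * x₁) (x₂, c + m * x₂) = {w | |w.2 - m * w.1| < c} := by
  have hd : 0 < |x₂ - x₁| := abs_pos.mpr (sub_ne_zero.mpr hx.symm)
  ext w
  have hw : areaForm w ((x₂, c + m * x₂) - (x₁, c + m * x₁)) =
      -((w.2 - m * w.1) * (x₂ - x₁)) := by
    simp only [areaForm_apply, Prod.fst_sub, Prod.snd_sub]
    ring
  have hxx : areaForm (x₁, c + m * x₁) (x₂, c + m * x₂) = -(c * (x₂ - x₁)) := by
    simp only [areaForm_apply]
    ring
  simp only [strip, Set.mem_ofPred_eq]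
  rw [hw, hxx, abs_neg, abs_neg, abs_mul, abs_mul, mul_lt_mul_iff_left₀ hd, abs_of_nonneg hc]

lemma volume_setOf_abs_sub_lt_inter_Icc (a b u v : ℝ) :
    volume (Set.Icc u v ∩ {y | |y - a| < b}) = ENNReal.ofReal (min v (a + b) - max u (a - b)) := by
  have hset : {y | |y - a| < b} = Set.Ioo (a - b) (a + b) := by
    rw [← Real.ball_eq_Ioo]
    rfl
  rw [hset, measure_congr ((ae_eq_refl (Set.Icc u v)).inter Ioo_ae_eq_Icc), Set.Icc_inter_Icc,
    Real.volume_Icc]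

lemma squareUnif_setOf_abs_sub_mul_lt_eq_lintegral (c m : ℝ) :
    squareUnif {w | |w.2 - m * w.1| < c} = 4⁻¹ * ∫⁻ x in Set.Icc (-1) 1,
      ENNReal.ofReal (min 1 (m * x + c) - max (-1) (m * x - c)) := by
  have hS : MeasurableSet {w : ℝ × ℝ | |w.2 - m * w.1| < c} :=
    measurableSet_lt (by fun_prop) measurable_const
  rw [squareUnif_apply, Measure.volume_eq_prod, Measure.prod_apply (measurableSet_square.inter hS),
    ← lintegral_indicator measurableSet_Icc]
  congr 1
  refine lintegral_congr fun x => ?_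
  by_cases hx : x ∈ Set.Icc (-1 : ℝ) 1
  · rw [Set.indicator_of_mem hx, ← volume_setOf_abs_sub_lt_inter_Icc, Set.preimage_inter, square,
      Set.mk_preimage_prod_right hx]
    rfl
  · rw [Set.indicator_of_notMem hx, Set.preimage_inter, square,
      Set.mk_preimage_prod_right_eq_empty hx, Set.empty_inter, measure_empty]

lemma squareUnif_setOf_abs_sub_mul_lt {c m : ℝ} (hc : 0 ≤ c) (hm : 0 < m) (hm1 : m ≤ 1)
    (hcm : c ≤ 1 + m) :
    squareUnif {w | |w.2 - m * w.1| < c} =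
      ENNReal.ofReal (c - max 0 (m + c - 1) ^ 2 / (4 * m)) := by
  have hslice : ∀ x, min 1 (m * x + c) - max (-1) (m * x - c) =
      2 * c - max 0 (m * x + (c - 1)) - max 0 (-m * x + (c - 1)) := fun x => by
    have hmin : min 1 (m * x + c) = m * x + c - max 0 (m * x + (c - 1)) := by
      rw [← min_sub_sub_left, min_comm]
      congr 1 <;> ring
    have hmax : max (-1) (m * x - c) = m * x - c + max 0 (-m * x + (c - 1)) := by
      rw [← max_add_add_left, max_comm]
      congr 1 <;> ring
    rw [hmin, hmax]
    ring
  have hint : ∫ x in (-1 : ℝ)..1, (min 1 (m * x + c) - max (-1) (m * x - c)) =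
      4 * c - max 0 (m + c - 1) ^ 2 / m := by
    have hzero : max 0 (-m + (c - 1)) = 0 := max_eq_left (by linarith)
    simp only [hslice]
    rw [intervalIntegral.integral_sub (Continuous.intervalIntegrable (by fun_prop) _ _)
        (Continuous.intervalIntegrable (by fun_prop) _ _),
      intervalIntegral.integral_sub (Continuous.intervalIntegrable (by fun_prop) _ _)
        (Continuous.intervalIntegrable (by fun_prop) _ _),
      integral_max_zero_mul_add hm.ne', integral_max_zero_mul_add (neg_ne_zero.mpr hm.ne'),
      intervalIntegral.integral_const, smul_eq_mul]
    simp only [mul_neg, mul_one, neg_neg, hzero, add_sub_assoc]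
    field_simp
    ring
  have hquarter : (4 : ENNReal)⁻¹ = ENNReal.ofReal 4⁻¹ := by
    rw [ENNReal.ofReal_inv_of_pos four_pos, ENNReal.ofReal_ofNat]
  rw [squareUnif_setOf_abs_sub_mul_lt_eq_lintegral, setLIntegral_congr Ioc_ae_eq_Icc.symm,
    ← ofReal_integral_eq_lintegral_ofReal
      (Continuous.intervalIntegrable (by fun_prop) (-1) 1).1 ?_,
    ← intervalIntegral.integral_of_le (by norm_num), hint, hquarter,
    ← ENNReal.ofReal_mul (by norm_num)]
  · congr 1
    field_simp
  · filter_upwards [ae_restrict_mem measurableSet_Ioc] with x hx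
    obtain ⟨hx₁, hx₂⟩ := hx
    refine sub_nonneg.mpr (max_le (le_min (by norm_num) ?_) (le_min ?_ ?_)) <;> nlinarith

lemma setLIntegral_setLIntegral_eq_lintegral_indicator {α β : Type*} [MeasurableSpace α]
    [MeasurableSpace β] {μ : Measure α} {ν : Measure β} {s : Set α} (hs : MeasurableSet s)
    {t : Set β} (ht : MeasurableSet t) (g : α → β → ENNReal) :
    ∫⁻ x in s, ∫⁻ y in t, g x y ∂ν ∂μ =
      ∫⁻ x, ∫⁻ y, g x y * (s.indicator 1 x * t.indicator 1 y) ∂ν ∂μ := by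
  rw [← lintegral_indicator hs]
  refine lintegral_congr fun x => ?_
  by_cases hx : x ∈ s
  · rw [Set.indicator_of_mem hx, ← lintegral_indicator ht]
    refine lintegral_congr fun y => ?_
    by_cases hy : y ∈ t <;> simp [hx, hy]
  · simp [hx]

lemma indicator_square_swap (z : ℝ × ℝ) :
    square.indicator (1 : ℝ × ℝ → ENNReal) z.swap = square.indicator 1 z := by
  simp only [Set.indicator_apply, square, Set.mem_prod, Prod.fst_swap, Prod.snd_swap,
    and_comm, Pi.one_apply]

lemma indicator_square_neg_fst (z : ℝ × ℝ) :
    square.indicator (1 : ℝ × ℝ → ENNReal) (-z.1, z.2) = square.indicator 1 z := by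
  simp only [Set.indicator_apply, square, Set.mem_prod, Set.neg_mem_Icc_iff, neg_neg, Pi.one_apply]

lemma indicator_square_neg_snd (z : ℝ × ℝ) :
    square.indicator (1 : ℝ × ℝ → ENNReal) (z.1, -z.2) = square.indicator 1 z := by
  simp only [Set.indicator_apply, square, Set.mem_prod, Set.neg_mem_Icc_iff, neg_neg, Pi.one_apply]

lemma linePairIntegral_mul_indicator {g : ℝ × ℝ → ℝ × ℝ → ENNReal} {c m : ℝ} {k : ENNReal}
    (hk : k ≠ ⊤) (hg : ∀ x₁ x₂, x₁ ≠ x₂ → g (x₁, c + m * x₁) (x₂, c + m * x₂) = k)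
    {K : Set (ℝ × ℝ)} (hK : MeasurableSet K) :
    linePairIntegral (fun z y => g z y * (K.indicator 1 z * K.indicator 1 y)) c m =
      k * ∫⁻ x in {x | (x, c + m * x) ∈ K} ×ˢ {x | (x, c + m * x) ∈ K},
        ENNReal.ofReal |x.2 - x.1| := by
  have hs : MeasurableSet {x | (x, c + m * x) ∈ K} := hK.preimage (by fun_prop)
  rw [linePairIntegral_eq_mul (f := fun z y => K.indicator 1 z * K.indicator 1 y) hk
    fun x₁ x₂ hx => by rw [hg x₁ x₂ hx], linePairIntegral, ← lintegral_indicator (hs.prod hs)]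
  congr 1
  refine lintegral_congr fun x => ?_
  by_cases h₁ : (x.1, c + m * x.1) ∈ K <;> by_cases h₂ : (x.2, c + m * x.2) ∈ K <;>
    simp [h₁, h₂]

/-- The integrand that has to be integrated over pairs of points of the plane to obtain the `n`-th
moment of the mass of the strip spanned by two points of the square. -/
noncomputable def squareStripPow (n : ℕ) (z y : ℝ × ℝ) : ENNReal :=
  squareUnif (strip z y) ^ n * (square.indicator 1 z * square.indicator 1 y)

lemma measurable_squareStripPow (n : ℕ) : Measurable (Function.uncurry (squareStripPow n)) := by
  have hstrip : Measurable fun p : (ℝ × ℝ) × (ℝ × ℝ) => squareUnif (strip p.1 p.2) :=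
    measurable_measure_prodMk_left measurableSet_strip
  have hind : Measurable (square.indicator (1 : ℝ × ℝ → ENNReal)) :=
    measurable_one.indicator measurableSet_square
  exact (hstrip.pow_const n).mul ((hind.comp measurable_fst).mul (hind.comp measurable_snd))

lemma setOf_line_mem_square_of_le {c m : ℝ} (hc : 0 ≤ c) (hm : 0 ≤ m) (hcm : c ≤ 1 - m) :
    {x | (x, c + m * x) ∈ square} = Set.Icc (-1) 1 := by
  ext x
  simp only [square, Set.mem_prod, Set.mem_ofPred_eq, Set.mem_Icc, and_iff_left_iff_imp]
  rintro ⟨h₁, h₂⟩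
  constructor <;> nlinarith

lemma setOf_line_mem_square_of_ge {c m : ℝ} (hm : 0 < m) (hm1 : m ≤ 1) (hcm : 1 - m ≤ c) :
    {x | (x, c + m * x) ∈ square} = Set.Icc (-1) ((1 - c) / m) := by
  ext x
  simp only [square, Set.mem_prod, Set.mem_ofPred_eq, Set.mem_Icc, le_div_iff₀ hm]
  constructor
  · rintro ⟨⟨h₁, _⟩, _, h₂⟩
    constructor <;> linarith
  · rintro ⟨h₁, h₂⟩
    refine ⟨⟨?_, ?_⟩, ?_, ?_⟩ <;> nlinarith

section LinePairIntegral

variable (n : ℕ) {c m : ℝ}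

lemma linePairIntegral_squareStripPow (hc : 0 ≤ c) (m : ℝ) :
    linePairIntegral (squareStripPow n) c m = squareUnif {w | |w.2 - m * w.1| < c} ^ n *
      ∫⁻ x in {x | (x, c + m * x) ∈ square} ×ˢ {x | (x, c + m * x) ∈ square},
        ENNReal.ofReal |x.2 - x.1| :=
  linePairIntegral_mul_indicator (ENNReal.pow_ne_top (measure_ne_top _ _))
    (fun x₁ x₂ hx => by rw [strip_line hc hx]) measurableSet_square

lemma linePairIntegral_squareStripPow_of_le (hc : 0 ≤ c) (hm : 0 < m) (hcm : c ≤ 1 - m) :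
    linePairIntegral (squareStripPow n) c m = ENNReal.ofReal (8 / 3 * c ^ n) := by
  have hmax : max 0 (m + c - 1) = 0 := max_eq_left (by linarith)
  rw [linePairIntegral_squareStripPow n hc, setOf_line_mem_square_of_le hc hm.le hcm,
    setLIntegral_Icc_prod_Icc_abs_sub (by norm_num),
    squareUnif_setOf_abs_sub_mul_lt hc hm (by linarith) (by linarith), hmax,
    ← ENNReal.ofReal_pow (by simpa using hc), ← ENNReal.ofReal_mul (by simpa using pow_nonneg hc n)]
  congr 1
  ring

lemma linePairIntegral_squareStripPow_of_mem_Icc (hc : 0 ≤ c) (hm : 0 < m) (hm1 : m ≤ 1)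
    (hcm : c ∈ Set.Icc (1 - m) (1 + m)) :
    linePairIntegral (squareStripPow n) c m =
      ENNReal.ofReal ((1 - (1 + m - c) ^ 2 / (4 * m)) ^ n * (((1 + m - c) / m) ^ 3 / 3)) := by
  have hmax : max 0 (m + c - 1) = m + c - 1 := max_eq_right (by linarith [hcm.1])
  have harea : c - (m + c - 1) ^ 2 / (4 * m) = 1 - (1 + m - c) ^ 2 / (4 * m) := by
    field_simp
    ring
  have hlength : (1 - c) / m - -1 = (1 + m - c) / m := by
    field_simp
    ring
  have hnonneg : 0 ≤ 1 - (1 + m - c) ^ 2 / (4 * m) := by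
    rw [sub_nonneg, div_le_one (by positivity)]
    nlinarith [hcm.1, hcm.2]
  rw [linePairIntegral_squareStripPow n hc, setOf_line_mem_square_of_ge hm hm1 hcm.1,
    setLIntegral_Icc_prod_Icc_abs_sub (by rw [le_div_iff₀ hm]; linarith [hcm.2]),
    squareUnif_setOf_abs_sub_mul_lt hc hm hm1 hcm.2, hmax, harea, hlength,
    ← ENNReal.ofReal_pow hnonneg, ← ENNReal.ofReal_mul (pow_nonneg hnonneg n)]

lemma linePairIntegral_squareStripPow_of_lt (hm : 0 < m) (hm1 : m ≤ 1) (hcm : 1 + m < c) :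
    linePairIntegral (squareStripPow n) c m = 0 := by
  have hempty : Set.Icc (-1) ((1 - c) / m) = ∅ :=
    Set.Icc_eq_empty (by rw [le_div_iff₀ hm]; linarith)
  rw [linePairIntegral_squareStripPow n (by linarith), setOf_line_mem_square_of_ge hm hm1
    (by linarith), hempty, Set.empty_prod, setLIntegral_empty, mul_zero]

lemma setLIntegral_linePairIntegral_squareStripPow_of_le (hm : 0 < m) (hm1 : m ≤ 1) :
    ∫⁻ c in Set.Ioc 0 (1 - m), linePairIntegral (squareStripPow n) c m =
      ENNReal.ofReal (8 / 3 * ((1 - m) ^ (n + 1) / (n + 1))) := by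
  rw [setLIntegral_congr_fun measurableSet_Ioc fun c hc =>
      linePairIntegral_squareStripPow_of_le n hc.1.le hm hc.2,
    lintegral_Ioc_ofReal_eq_sub (G := fun c => 8 / 3 * (c ^ (n + 1) / (n + 1))) (sub_nonneg.mpr hm1)
      (fun c _ => ?_) (by fun_prop) fun c hc => mul_nonneg (by norm_num) (pow_nonneg hc.1 n)]
  · rw [zero_pow n.succ_ne_zero, zero_div, mul_zero, sub_zero]
  · refine (((hasDerivAt_pow (n + 1) c).div_const _).const_mul _).congr_deriv ?_
    push_cast
    field_simp

/- On this range the mass `F` of the strip satisfies `F' = ℓ / 2` and `1 - F = m ℓ² / 4`, where `ℓ`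
is the length of the interval of abscissas, so that `F ^ n * ℓ ^ 3 / 3` is a polynomial in `F`
times `F'`. -/
lemma setLIntegral_linePairIntegral_squareStripPow_of_mem_Ioc (hm : 0 < m) (hm1 : m ≤ 1) :
    ∫⁻ c in Set.Ioc (1 - m) (1 + m), linePairIntegral (squareStripPow n) c m =
      ENNReal.ofReal (8 / (3 * m) * ((1 - (1 - m) ^ (n + 1)) / (n + 1) -
        (1 - (1 - m) ^ (n + 2)) / (n + 2))) := by
  have hderiv : ∀ c,
      HasDerivAt (fun c => 1 - (1 + m - c) ^ 2 / (4 * m)) ((1 + m - c) / (2 * m)) c := fun c =>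
    ((((hasDerivAt_id' c).const_sub (1 + m)).pow 2).div_const (4 * m)).const_sub 1
      |>.congr_deriv (by field_simp; ring)
  rw [setLIntegral_congr_fun measurableSet_Ioc fun c hc =>
      linePairIntegral_squareStripPow_of_mem_Icc n (by linarith [hc.1]) hm hm1 ⟨hc.1.le, hc.2⟩,
    lintegral_Ioc_ofReal_eq_sub (G := fun c => 8 / (3 * m) *
      ((1 - (1 + m - c) ^ 2 / (4 * m)) ^ (n + 1) / (n + 1) -
        (1 - (1 + m - c) ^ 2 / (4 * m)) ^ (n + 2) / (n + 2))) (by linarith)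
      (fun c _ => ?_) (by fun_prop) fun c hc => ?_]
  · have hend : 1 - (1 + m - (1 - m)) ^ 2 / (4 * m) = 1 - m := by
      field_simp
      ring
    rw [hend, sub_self, zero_pow two_ne_zero, zero_div, sub_zero, one_pow, one_pow]
    congr 1
    ring
  · refine (((((hderiv c).pow (n + 1)).div_const _).sub
      (((hderiv c).pow (n + 2)).div_const _)).const_mul _).congr_deriv ?_
    obtain ⟨F, hF⟩ : ∃ F, F = 1 - (1 + m - c) ^ 2 / (4 * m) := ⟨_, rfl⟩
    have hlength : (1 + m - c) ^ 2 = 4 * m * (1 - F) := by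
      rw [hF]
      field_simp
      ring
    rw [← hF, Nat.add_sub_cancel, show n + 2 - 1 = n + 1 from rfl, pow_succ F n]
    push_cast
    field_simp
    linear_combination -2 * F ^ n * (1 + m - c) * hlength
  · have hnonneg : 0 ≤ 1 - (1 + m - c) ^ 2 / (4 * m) := by
      rw [sub_nonneg, div_le_one (by positivity)]
      nlinarith [hc.1, hc.2]
    have hlength : 0 ≤ 1 + m - c := sub_nonneg.mpr hc.2
    positivity

lemma setLIntegral_Ioi_linePairIntegral_squareStripPow (hm : 0 < m) (hm1 : m ≤ 1) :
    ∫⁻ c in Set.Ioi 0, linePairIntegral (squareStripPow n) c m =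
      ENNReal.ofReal (8 / (3 * (n + 1) * (n + 2)) * ∑ k ∈ Finset.range (n + 2), (1 - m) ^ k) := by
  have hout : ∫⁻ c in Set.Ioi (1 + m), linePairIntegral (squareStripPow n) c m = 0 := by
    rw [setLIntegral_congr_fun measurableSet_Ioi fun c hc =>
      linePairIntegral_squareStripPow_of_lt n hm hm1 hc, lintegral_zero]
  have hpow := add_two_mul_pow_add_one_le n (sub_nonneg.mpr hm1)
  have hgeom : m * ∑ k ∈ Finset.range (n + 2), (1 - m) ^ k = 1 - (1 - m) ^ (n + 2) := by
    rw [← mul_neg_geom_sum, sub_sub_cancel]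
  rw [← Set.Ioc_union_Ioi_eq_Ioi (show 0 ≤ 1 + m by linarith),
    lintegral_union measurableSet_Ioi (Set.Ioc_disjoint_Ioi le_rfl), hout, add_zero,
    ← Set.Ioc_union_Ioc_eq_Ioc (sub_nonneg.mpr hm1) (show 1 - m ≤ 1 + m by linarith),
    lintegral_union measurableSet_Ioc (Set.Ioc_disjoint_Ioc_of_le le_rfl),
    setLIntegral_linePairIntegral_squareStripPow_of_le n hm hm1,
    setLIntegral_linePairIntegral_squareStripPow_of_mem_Ioc n hm hm1, ← ENNReal.ofReal_add]
  · congr 1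
    rw [pow_succ _ (n + 1)] at hgeom ⊢
    field_simp
    linear_combination -hgeom
  · have := sub_nonneg.mpr hm1
    positivity
  · refine mul_nonneg (by positivity) (sub_nonneg.mpr ?_)
    rw [div_le_div_iff₀ (by positivity) (by positivity)]
    linarith

end LinePairIntegral

theorem lintegral_lintegral_squareUnif_strip_pow (n : ℕ) :
    ∫⁻ z, ∫⁻ y, squareUnif (strip z y) ^ n ∂squareUnif ∂squareUnif =
      ENNReal.ofReal (4 / (3 * (n + 1) * (n + 2)) *
        ∑ k ∈ Finset.range (n + 2), 1 / ((k : ℝ) + 1)) := by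
  have hswap : ∀ z y, squareStripPow n z.swap y.swap = squareStripPow n z y :=
    fun z y => by simp only [squareStripPow, squareUnif_strip_swap, indicator_square_swap]
  have hfst : ∀ z y, squareStripPow n (-z.1, z.2) (-y.1, y.2) = squareStripPow n z y :=
    fun z y => by simp only [squareStripPow, squareUnif_strip_neg_fst, indicator_square_neg_fst]
  have hsnd : ∀ z y, squareStripPow n (z.1, -z.2) (y.1, -y.2) = squareStripPow n z y :=
    fun z y => by simp only [squareStripPow, squareUnif_strip_neg_snd, indicator_square_neg_snd]
  have hquarter : (4 : ENNReal)⁻¹ = ENNReal.ofReal 4⁻¹ := by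
    rw [ENNReal.ofReal_inv_of_pos four_pos, ENNReal.ofReal_ofNat]
  simp only [lintegral_squareUnif]
  rw [lintegral_const_mul' _ _ (by simp), setLIntegral_setLIntegral_eq_lintegral_indicator
    measurableSet_square measurableSet_square]
  change 4⁻¹ * (4⁻¹ * ∫⁻ z, ∫⁻ y, squareStripPow n z y) = _
  rw [lintegral_lintegral_eq_eight_mul (measurable_squareStripPow n) hswap hfst hsnd,
    setLIntegral_congr_fun measurableSet_Ioc fun m hm =>
      setLIntegral_Ioi_linePairIntegral_squareStripPow n hm.1 hm.2,
    setLIntegral_geom_sum_one_sub _ (by positivity), hquarter, ← ENNReal.ofReal_ofNat 8,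
    ← ENNReal.ofReal_mul (by norm_num), ← ENNReal.ofReal_mul (by norm_num),
    ← ENNReal.ofReal_mul (by norm_num)]
  congr 1
  ring

end Square

section RandomHull

variable (n : ℕ)

lemma measurable_squareUnif_compl_absConvexHull_range :
    Measurable fun y : Fin (n + 1) → ℝ × ℝ => squareUnif (absConvexHull ℝ (Set.range y))ᶜ :=
  measurable_measure_prodMk_left isOpen_setOf_notMem_absConvexHull_range.measurableSet

lemma squareUnif_real_absConvexHull_range {N : ℕ} (y : Fin N → ℝ × ℝ) :
    squareUnif.real (absConvexHull ℝ (Set.range y)) =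
      1 - (squareUnif (absConvexHull ℝ (Set.range y))ᶜ).toReal := by
  have h := probReal_compl_eq_one_sub (μ := squareUnif)
    (isCompact_absConvexHull_range y).isClosed.measurableSet
  rw [← Measure.real_def, h, sub_sub_cancel]

lemma integrable_squareUnif_compl_absConvexHull_range :
    Integrable (fun y : Fin (n + 1) → ℝ × ℝ =>
      (squareUnif (absConvexHull ℝ (Set.range y))ᶜ).toReal) (Measure.pi fun _ => squareUnif) :=
  Integrable.of_bound
    (measurable_squareUnif_compl_absConvexHull_range n).ennreal_toReal.aestronglyMeasurable 1
    (Filter.Eventually.of_forall fun _ => by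
      rw [Real.norm_of_nonneg ENNReal.toReal_nonneg]
      exact measureReal_le_one)

lemma integrable_squareUnif_real_absConvexHull_range :
    Integrable (fun y : Fin (n + 1) → ℝ × ℝ => squareUnif.real (absConvexHull ℝ (Set.range y)))
      (Measure.pi fun _ => squareUnif) := by
  simp only [squareUnif_real_absConvexHull_range]
  exact (integrable_const 1).sub (integrable_squareUnif_compl_absConvexHull_range n)

theorem integral_squareUnif_real_absConvexHull_range :
    ∫ y, squareUnif.real (absConvexHull ℝ (Set.range y))
        ∂(Measure.pi fun _ : Fin (n + 1) => squareUnif) =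
      1 - 4 / (3 * (n + 2)) * ∑ k ∈ Finset.range (n + 2), 1 / ((k : ℝ) + 1) := by
  simp only [squareUnif_real_absConvexHull_range]
  rw [integral_sub (integrable_const 1) (integrable_squareUnif_compl_absConvexHull_range n),
    integral_const, probReal_univ, one_smul, integral_toReal
      (measurable_squareUnif_compl_absConvexHull_range n).aemeasurable
      (Filter.Eventually.of_forall fun _ => measure_lt_top _ _),
    lintegral_measure_compl_absConvexHull_range squareUnif_absolutelyContinuous,
    lintegral_lintegral_squareUnif_strip_pow, ENNReal.toReal_mul,
    ENNReal.toReal_ofReal (by positivity)]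
  simp only [ENNReal.toReal_add (ENNReal.natCast_ne_top n) ENNReal.one_ne_top,
    ENNReal.toReal_natCast, ENNReal.toReal_one]
  field_simp

end RandomHull

section Transfer

lemma map_cond_eq_cond_image {E F : Type*} [NormedAddCommGroup E] [NormedSpace ℝ E]
    [MeasurableSpace E] [BorelSpace E] [NormedAddCommGroup F] [NormedSpace ℝ F]
    [FiniteDimensional ℝ F] [MeasurableSpace F] [BorelSpace F] (μ : Measure E) [μ.IsAddHaarMeasure]
    (ν : Measure F) [ν.IsAddHaarMeasure] (T : E ≃L[ℝ] F) {s : Set E} (hs : MeasurableSet s) :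
    Measure.map T (cond μ s) = cond ν (T '' s) := by
  let e := T.toHomeomorph.toMeasurableEquiv
  have hmap : ∀ t, Measure.map T μ (T '' t) = μ t := fun t =>
    (e.map_apply _).trans (congrArg μ (Set.preimage_image_eq t T.injective))
  have hscale : ν = Measure.addHaarScalarFactor ν (Measure.map T μ) • Measure.map T μ :=
    Measure.isAddLeftInvariant_eq_smul ν (Measure.map T μ)
  have hpos : (Measure.addHaarScalarFactor ν (Measure.map T μ) : ENNReal) ≠ 0 := by
    exact_mod_cast (Measure.addHaarScalarFactor_pos_of_isAddHaarMeasure ν (Measure.map T μ)).ne'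
  have himage : ∀ t, ν (T '' t) =
      Measure.addHaarScalarFactor ν (Measure.map T μ) * μ t := fun t => by
    conv_lhs => rw [hscale]
    rw [Measure.smul_apply, hmap]
    rfl
  have hTs : MeasurableSet (T '' s) := e.measurableSet_image.mpr hs
  ext t ht
  rw [Measure.map_apply T.continuous.measurable ht, cond_apply hs,
    cond_apply hTs, ← Set.image_inter_preimage, himage, himage,
    ENNReal.mul_inv (Or.inl hpos) (Or.inl ENNReal.coe_ne_top), mul_mul_mul_comm,
    ENNReal.inv_mul_cancel hpos ENNReal.coe_ne_top, one_mul]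

lemma symmConvexHull_eq_absConvexHull {n N : ℕ} (x : Fin N → EuclideanSpace ℝ (Fin n)) :
    symmConvexHull x = absConvexHull ℝ (Set.range x) := by
  rw [symmConvexHull, ← convexHull_union_neg_eq_absConvexHull, ← Set.image_neg_eq_neg,
    ← Set.range_comp]
  rfl

lemma image_absConvexHull {E F : Type*} [AddCommGroup E] [Module ℝ E] [AddCommGroup F]
    [Module ℝ F] (f : E →ₗ[ℝ] F) (s : Set E) :
    f '' absConvexHull ℝ s = absConvexHull ℝ (f '' s) := by
  rw [← convexHull_union_neg_eq_absConvexHull, ← convexHull_union_neg_eq_absConvexHull,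
    f.image_convexHull, Set.image_union, Set.image_neg]

lemma normalizedSymmVolume_eq_cond_real {n N : ℕ} {K : Set (EuclideanSpace ℝ (Fin n))}
    (hK : AbsConvex ℝ K) (hKm : MeasurableSet K) {x : Fin N → EuclideanSpace ℝ (Fin n)}
    (hx : ∀ i, x i ∈ K) :
    normalizedSymmVolume K x = (cond volume K).real (absConvexHull ℝ (Set.range x)) := by
  have hsub : absConvexHull ℝ (Set.range x) ⊆ K :=
    absConvexHull_min (Set.range_subset_iff.mpr hx) hK
  rw [normalizedSymmVolume, symmConvexHull_eq_absConvexHull, Measure.real_def, cond_apply hKm,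
    Set.inter_eq_right.mpr hsub, ENNReal.toReal_mul, ENNReal.toReal_inv, div_eq_inv_mul]

lemma square_eq_closedBall : square = Metric.closedBall 0 1 := by
  rw [square, ← Prod.mk_zero_zero, ← closedBall_prod_same, Real.closedBall_eq_Icc, zero_sub,
    zero_add]

lemma absConvex_image_square {F : Type*} [AddCommGroup F] [Module ℝ F] (f : ℝ × ℝ →ₗ[ℝ] F) :
    AbsConvex ℝ (f '' square) := by
  have hsquare : AbsConvex ℝ square := by
    rw [square_eq_closedBall]
    exact ⟨balanced_closedBall_zero, convex_closedBall 0 1⟩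
  rw [← absConvexHull_eq_self, ← image_absConvexHull, absConvexHull_eq_self.mpr hsquare]

section Image

variable (T : (ℝ × ℝ) ≃L[ℝ] EuclideanSpace ℝ (Fin 2))

lemma normalizedSymmVolume_image_square {N : ℕ} {x : Fin N → EuclideanSpace ℝ (Fin 2)}
    (hx : ∀ i, x i ∈ T '' square) :
    normalizedSymmVolume (T '' square) x =
      squareUnif.real (absConvexHull ℝ (Set.range fun i => T.symm (x i))) := by
  have hmeas : MeasurableSet (T '' square) :=
    T.toHomeomorph.toMeasurableEquiv.measurableSet_image.mpr measurableSet_square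
  have hconvex : AbsConvex ℝ (T '' square) := absConvex_image_square T.toLinearEquiv.toLinearMap
  have hrange : Set.range x = T '' Set.range fun i => T.symm (x i) := by
    rw [← Set.range_comp]
    simp only [Function.comp_def, ContinuousLinearEquiv.apply_symm_apply]
  have hpre : T ⁻¹' absConvexHull ℝ (Set.range x) =
      absConvexHull ℝ (Set.range fun i => T.symm (x i)) := by
    have himage := image_absConvexHull (T : ℝ × ℝ →ₗ[ℝ] EuclideanSpace ℝ (Fin 2))
      (Set.range fun i => T.symm (x i))
    rw [hrange]
    exact (congrArg _ himage.symm).trans (Set.preimage_image_eq _ T.injective)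
  rw [normalizedSymmVolume_eq_cond_real hconvex hmeas hx,
    ← map_cond_eq_cond_image volume volume T measurableSet_square,
    map_measureReal_apply T.continuous.measurable
      (isCompact_absConvexHull_range x).isClosed.measurableSet, hpre, squareUnif]

end Image

lemma eq_zero_of_forall_add_mem {E : Type*} [NormedAddCommGroup E] [NormedSpace ℝ E] {K : Set E}
    (hK : Bornology.IsBounded K) (hne : K.Nonempty) {v : E} (hv : ∀ x ∈ K, v + x ∈ K) : v = 0 := by
  obtain ⟨x, hx⟩ := hne
  have hmem : ∀ n : ℕ, n • v + x ∈ K := fun n => by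
    induction n with
    | zero => simpa using hx
    | succ n ih => simpa only [succ_nsmul', add_assoc] using hv _ ih
  obtain ⟨r, hr⟩ := hK.exists_norm_le
  by_contra hv₀
  obtain ⟨n, hn⟩ := Archimedean.arch (r + ‖x‖ + 1) (norm_pos_iff.mpr hv₀)
  have h₁ := norm_sub_le (n • v + x) x
  rw [add_sub_cancel_right, ← Nat.cast_smul_eq_nsmul ℝ, norm_smul, RCLike.norm_natCast] at h₁
  rw [nsmul_eq_mul] at hn
  have h₂ := hr _ (hmem n)
  rw [← Nat.cast_smul_eq_nsmul ℝ] at h₂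
  linarith

lemma IsParallelogram.exists_vadd_image_square {P : Set (EuclideanSpace ℝ (Fin 2))}
    (hP : IsParallelogram P) :
    ∃ (e : EuclideanSpace ℝ (Fin 2)) (T : (ℝ × ℝ) ≃L[ℝ] EuclideanSpace ℝ (Fin 2)),
      P = e +ᵥ T '' square := by
  obtain ⟨c, a, b, hab, rfl⟩ := hP
  let f : (ℝ × ℝ) →ₗ[ℝ] EuclideanSpace ℝ (Fin 2) :=
    (LinearMap.fst ℝ ℝ ℝ).smulRight ((1 / 2 : ℝ) • a) +
      (LinearMap.snd ℝ ℝ ℝ).smulRight ((1 / 2 : ℝ) • b)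
  have hf : ∀ p : ℝ × ℝ, f p = (p.1 / 2) • a + (p.2 / 2) • b := fun p => by
    simp only [f, LinearMap.add_apply, LinearMap.smulRight_apply, LinearMap.fst_apply,
      LinearMap.snd_apply, smul_smul, mul_one_div]
  have hinj : Function.Injective f := (injective_iff_map_eq_zero f).mpr fun p hp => by
    obtain ⟨h₁, h₂⟩ := LinearIndependent.pair_iff.mp hab _ _ ((hf p).symm.trans hp)
    exact Prod.ext (by simpa using h₁) (by simpa using h₂)
  refine ⟨c + (1 / 2 : ℝ) • a + (1 / 2 : ℝ) • b,
    (LinearEquiv.ofInjectiveOfFinrankEq f hinj (by simp)).toContinuousLinearEquiv, ?_⟩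
  have hpoint : ∀ p, c + (1 / 2 : ℝ) • a + (1 / 2 : ℝ) • b + f p =
      c + ((1 + p.1) / 2) • a + ((1 + p.2) / 2) • b := fun p => by
    rw [hf]
    module
  ext x
  change (∃ s ∈ _, ∃ t ∈ _, _) ↔ ∃ z ∈ f '' square, _ + z = x
  simp only [Set.exists_mem_image, hpoint]
  constructor
  · rintro ⟨s, ⟨hs₀, hs₁⟩, t, ⟨ht₀, ht₁⟩, rfl⟩
    refine ⟨(2 * s - 1, 2 * t - 1), ⟨⟨by linarith, by linarith⟩, by linarith, by linarith⟩, ?_⟩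
    simp only [add_sub_cancel, mul_div_cancel_left₀, ne_eq, two_ne_zero, not_false_eq_true]
  · rintro ⟨p, ⟨⟨hs₀, hs₁⟩, ht₀, ht₁⟩, rfl⟩
    exact ⟨(1 + p.1) / 2, ⟨by linarith, by linarith⟩, (1 + p.2) / 2,
      ⟨by linarith, by linarith⟩, rfl⟩

lemma IsParallelogram.exists_eq_image_square {P : Set (EuclideanSpace ℝ (Fin 2))}
    (hP : IsParallelogram P) (hsymm : -P = P) :
    ∃ T : (ℝ × ℝ) ≃L[ℝ] EuclideanSpace ℝ (Fin 2), P = T '' square := by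
  obtain ⟨e, T, rfl⟩ := hP.exists_vadd_image_square
  have hneg : ∀ x ∈ T '' square, -x ∈ T '' square := fun x hx =>
    (absConvex_image_square T.toLinearEquiv.toLinearMap).1.neg_mem_iff.mpr hx
  have hcompact : IsCompact (T '' square) :=
    (isCompact_Icc.prod isCompact_Icc).image T.continuous
  have hcenter : (2 : ℝ) • e = 0 := by
    refine eq_zero_of_forall_add_mem hcompact.isBounded
      ⟨0, 0, by simp [square_eq_closedBall], map_zero T⟩ fun x hx => ?_
    obtain ⟨x', hx', h⟩ : -(e + x) ∈ e +ᵥ T '' square := by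
      rw [← hsymm]
      exact Set.neg_mem_neg.mpr (Set.vadd_mem_vadd_set hx)
    convert hneg x' hx' using 1
    rw [eq_sub_of_add_eq' (show e + x' = -(e + x) from h)]
    module
  refine ⟨T, ?_⟩
  rw [(smul_eq_zero.mp hcenter).resolve_left two_ne_zero, zero_vadd]

section UniformPoints

variable {Ω : Type*} [MeasurableSpace Ω] {μ : Measure Ω}
  {T : (ℝ × ℝ) ≃L[ℝ] EuclideanSpace ℝ (Fin 2)}

lemma aemeasurable_of_isUniform_image_square {X : Ω → EuclideanSpace ℝ (Fin 2)}
    (hX : pdf.IsUniform X (T '' square) μ volume) : AEMeasurable X μ := by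
  refine AEMeasurable.of_map_ne_zero ?_
  rw [hX, ← map_cond_eq_cond_image volume volume T measurableSet_square]
  exact (Measure.map_ne_zero_iff T.continuous.aemeasurable).mpr
    (IsProbabilityMeasure.ne_zero squareUnif)

lemma map_symm_comp_of_isUniform_image_square {X : Ω → EuclideanSpace ℝ (Fin 2)}
    (hX : pdf.IsUniform X (T '' square) μ volume) : μ.map (fun ω => T.symm (X ω)) = squareUnif := by
  have hT : Measurable T := T.continuous.measurable
  have hTsymm : Measurable T.symm := T.symm.continuous.measurable
  change μ.map (T.symm ∘ X) = _
  rw [← AEMeasurable.map_map_of_aemeasurable hTsymm.aemeasurable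
    (aemeasurable_of_isUniform_image_square hX), hX,
    ← map_cond_eq_cond_image volume volume T measurableSet_square, Measure.map_map hTsymm hT,
    T.symm_comp_self, Measure.map_id, squareUnif]

lemma ae_mem_of_isUniform_image_square {X : Ω → EuclideanSpace ℝ (Fin 2)}
    (hX : pdf.IsUniform X (T '' square) μ volume) : ∀ᵐ ω ∂μ, X ω ∈ T '' square := by
  refine ae_of_ae_map (aemeasurable_of_isUniform_image_square hX) ?_
  rw [hX]
  exact ae_cond_mem (T.toHomeomorph.toMeasurableEquiv.measurableSet_image.mpr measurableSet_square)

lemma map_symm_comp_pi_of_isUniform_image_square {ι : Type*} [Fintype ι]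
    {X : ι → Ω → EuclideanSpace ℝ (Fin 2)} (hindep : iIndepFun X μ)
    (hX : ∀ i, pdf.IsUniform (X i) (T '' square) μ volume) :
    μ.map (fun ω i => T.symm (X i ω)) = Measure.pi fun _ => squareUnif := by
  have hTsymm : Measurable T.symm := T.symm.continuous.measurable
  have hlaw := iIndepFun.map_fun_eq_pi_map
    (fun i => hTsymm.comp_aemeasurable (aemeasurable_of_isUniform_image_square (hX i)))
    (hindep.comp (fun _ => T.symm) fun _ => hTsymm)
  simpa only [Function.comp_def, map_symm_comp_of_isUniform_image_square (hX _)] using hlaw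

end UniformPoints

end Transfer

lemma sum_Icc_one_div_eq_sum_range (n : ℕ) :
    ∑ k ∈ Finset.Icc 1 n, 1 / (k : ℝ) = ∑ k ∈ Finset.range n, 1 / ((k : ℝ) + 1) := by
  rw [Finset.range_eq_Ico, ← Finset.Ico_add_one_right_eq_Icc,
    ← Finset.sum_Ico_add' (fun k : ℕ => 1 / (k : ℝ)) 0 n 1]
  simp only [Nat.cast_add, Nat.cast_one]

theorem mainTheorem5
    (P : Set (EuclideanSpace ℝ (Fin 2))) (hP : IsParallelogram P) (hsymm : -P = P)
    (N : ℕ) (hN : 2 ≤ N)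
    {Ω : Type*} [MeasurableSpace Ω] (μ : Measure Ω) [IsProbabilityMeasure μ]
    (X : Fin N → Ω → EuclideanSpace ℝ (Fin 2))
    (hindep : iIndepFun X μ)
    (hunif : ∀ i, pdf.IsUniform (X i) P μ volume) :
    Integrable (fun ω => normalizedSymmVolume P (fun i => X i ω)) μ ∧
      ∫ ω, normalizedSymmVolume P (fun i => X i ω) ∂μ =
        1 - 4 / (3 * ((N : ℝ) + 1)) * ∑ k ∈ Finset.Icc 1 (N + 1), 1 / (k : ℝ) := by
  obtain ⟨T, rfl⟩ := hP.exists_eq_image_square hsymm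
  obtain ⟨n, rfl⟩ : ∃ n, N = n + 1 := ⟨N - 1, by omega⟩
  have hlaw := map_symm_comp_pi_of_isUniform_image_square hindep hunif
  have hYm : AEMeasurable (fun ω i => T.symm (X i ω)) μ := aemeasurable_pi_lambda _ fun i =>
    T.symm.continuous.measurable.comp_aemeasurable
      (aemeasurable_of_isUniform_image_square (hunif i))
  have hvol : (fun ω => normalizedSymmVolume (T '' square) fun i => X i ω) =ᵐ[μ]
      fun ω => squareUnif.real (absConvexHull ℝ (Set.range fun i => T.symm (X i ω))) :=
    (ae_all_iff.mpr fun i => ae_mem_of_isUniform_image_square (hunif i)).mono fun ω hω =>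
      normalizedSymmVolume_image_square T hω
  have hint := hlaw ▸ integrable_squareUnif_real_absConvexHull_range n
  refine ⟨(hint.comp_aemeasurable hYm).congr hvol.symm, ?_⟩
  rw [integral_congr_ae hvol, ← integral_map (f := fun y : Fin (n + 1) → ℝ × ℝ =>
      squareUnif.real (absConvexHull ℝ (Set.range y))) hYm hint.aestronglyMeasurable, hlaw,
    integral_squareUnif_real_absConvexHull_range, sum_Icc_one_div_eq_sum_range, Nat.cast_add_one,
    add_assoc, one_add_one_eq_two]
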